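/- **Setting.** Let $k\ge 0$. A $k$-graph is a nonempty countable small category $\Lambda$ with a functor $d:\Lambda\to\mathbb N^k$ (we identify $\Lambda$ with its set of morphisms, called paths, and objects with identity morphisms) such that whenever $d(\lambda)=m+n$ there are unique $\mu,\nu$ with $d(\mu)=m$, $d(\nu)=n$ and $\lambda=\mu\nu$. Write $\Lambda^n=d^{-1}(n)$, and $s,r$ for domain and codomain. $\Lambda$ is row-finite with no sources if $v\Lambda^n=\{\lambda\in\Lambda^n: r(\lambda)=v\}$ is finite and nonempty for all $v\in\Lambda^0$, $n\in\mathbb N^k$. An $A$-$B$ $C^*$-correspondence is a right Hilbert $B$-module $E$ with a $*$-homomorphism $\phi:A\to\mathcal L(E)$. A $\Lambda$-system $(A,X,\chi)$ of $C^*$-correspondences consists of a $C^*$-algebra $A_v$ for each $v\in\Lambda^0$, an $A_{r(\lambda)}$-$A_{s(\lambda)}$ correspondence $X_\lambda$ with left action $\phi_\lambda$ for each $\lambda\in\Lambda$, where $X_v$ is the identity correspondence $A_v$ for $v\in\Lambda^0$, and, for all $\alpha,\beta$ with $s(\alpha)=r(\beta)$, a map of correspondences $\chi_{\alpha,\beta}:X_\alpha\otimes_{A_{s(\alpha)}}X_\beta\to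 X_{\alpha\beta}$, which is an isomorphism if $\alpha\notin\Lambda^0$, such that $\chi_{r(\lambda),\lambda}(a\otimes x)=\phi_\lambda(a)x$, $\chi_{\lambda,s(\lambda)}(x\otimes a)=x\cdot a$, and $\chi_{\alpha\beta,\gamma}(\chi_{\alpha,\beta}\otimes 1)=\chi_{\alpha,\beta\gamma}(1\otimes\chi_{\beta,\gamma})$. It is regular if $\Lambda$ is row-finite with no sources, each $X_\lambda$ is nondegenerate and full, and each $\phi_\lambda$ is injective with values in $\mathcal K(X_\lambda)$. A representation of $X$ in a $C^*$-algebra $B$ is a pair $(\rho,\pi)$ of families of linear maps $\rho_\lambda:X_\lambda\to B$ and $*$-homomorphisms $\pi_v:A_v\to B$ such that (1) $\rho_v=\pi_v$ for $v\in\Lambda^0$; (2) for $x\in X_\alpha$, $y\in X_\beta$, $\rho_\alpha(x)\rho_\beta(y)$ is $\rho_{\alpha\beta}(\chi_{\alpha,\beta}(x\otimes y))$ if $s(\alpha)=r(\beta)$ and $0$ otherwise; (3) if $d(\alpha)=d(\beta)$, then $\rho_\alpha(x)^*\rho_\beta(y)$ is $\pi_{s(\alpha)}(\langle x,y\rangle)$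 if $\alpha=\beta$ and $0$ otherwise. It is universal if for every representation $(\rho',\pi')$ of $X$ in a $C^*$-algebra $C$ there is a unique $*$-homomorphism $\Phi:B\to C$ with $\Phi\circ\rho_\lambda=\rho'_\lambda$ for all $\lambda\in\Lambda$ and $\Phi\circ\pi_v=\pi'_v$ for all $v\in\Lambda^0$. Let $A=\bigoplus_{v}A_v$ ($c_0$-direct sum) and regard each $X_\lambda$ as an $A$-$A$ correspondence. Let $Y_n=\bigoplus_{\lambda\in\Lambda^n}X_\lambda$ ($\ell^2$-direct sum), so that $Y_0=A$, with inclusions $\iota_\lambda:X_\lambda\to Y_{d(\lambda)}$ and $\iota_v:A_v\to A=Y_0$. Then $Y=Y_X=\bigsqcup_{n\in\mathbb N^k}Y_n$ is the product system over $\mathbb N^k$ with multiplication determined by $\iota_\alpha(x)\iota_\beta(y)=\iota_{\alpha\beta}(\chi_{\alpha,\beta}(x\otimes y))$ if $s(\alpha)=r(\beta)$, and $0$ otherwise. A representation of $Y$ in a $C^*$-algebra $B$ is a map $\psi:Y\to B$, with restrictions $\psi_n=\psi|_{Y_n}$, such that $\psi_0:A\to B$ is a $*$-homomorphism, each $\psi_n$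 is linear with $\psi_n(a\cdot y)=\psi_0(a)\psi_n(y)$, $\psi_n(y\cdot a)=\psi_n(y)\psi_0(a)$ and $\psi_0(\langle y,z\rangle)=\psi_n(y)^*\psi_n(z)$, and $\psi_m(x)\psi_n(y)=\psi_{m+n}(xy)$. The Toeplitz algebra $\mathcal T_Y$ is a $C^*$-algebra generated by the image of a representation $i_Y:Y\to\mathcal T_Y$ such that for every representation $\psi$ of $Y$ in a $C^*$-algebra $B$ there is a $*$-homomorphism $\psi_*:\mathcal T_Y\to B$ with $\psi_*\circ i_Y=\psi$. **Proposition 3.2.3.** Let $\Lambda$ be a row-finite $k$-graph with no sources, let $X$ be a regular $\Lambda$-system of $C^*$-correspondences, and let $Y=Y_X$. 1. If $\psi$ is a representation of $Y$ in a $C^*$-algebra $B$, then $\rho^\psi_\alpha:=\psi\circ\iota_\alpha$ $(\alpha\in\Lambda)$ and $\pi^\psi_v:=\psi\circ\iota_v$ $(v\in\Lambda^0)$ define a representation $(\rho^\psi,\pi^\psi)$ of $X$ in $B$. 2. If $(\rho,\pi)$ is a representation of $X$ in a $C^*$-algebra $B$, then there is a unique representation $\psi^{(\rho,\pi)}$ of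 $Y$ in $B$ such that $\psi^{(\rho,\pi)}(\iota_\alpha(x))=\rho_\alpha(x)$ for all $\alpha\in\Lambda$ and $x\in X_\alpha$. These constructions are mutually inverse: $\psi^{(\rho^\psi,\pi^\psi)}=\psi$ for every representation $\psi$ of $Y$, and $(\rho^{\psi^{(\rho,\pi)}},\pi^{\psi^{(\rho,\pi)}})=(\rho,\pi)$ for every representation $(\rho,\pi)$ of $X$. Moreover, the Toeplitz algebra $(\mathcal T_Y,i_Y)$ exists, and the representation $(\rho^{i_Y},\pi^{i_Y})$ of $X$ in $\mathcal T_Y$ is universal. -/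

import Mathlib

open scoped ENNReal
open CategoryTheory Filter Topology

universe u

noncomputable section

/-- A `C*`-correspondence from `A` to `B`: a right Hilbert `B`-module together with a
`*`-homomorphism `φ` from `A` into its adjointable operators.

The inner product is linear in the second variable, and `x · b` is written `rsmul x b`.
Positivity of an element of a `C*`-algebra is expressed as being of the form `b* b`; definiteness
of the inner product is contained in `norm_sq`.  A map with an adjoint is automatically bounded
and right `B`-linear, so `inner_φ` says precisely that `φ a` is adjointable with adjoint
`φ a*`. -/
structure Corr (A B : Type u) [NonUnitalCStarAlgebra A] [NonUnitalCStarAlgebra B] where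
  carrier : Type u
  [normedAddCommGroup : NormedAddCommGroup carrier]
  [normedSpace : NormedSpace ℂ carrier]
  [completeSpace : CompleteSpace carrier]
  /-- the right action `x · b` -/
  rsmul : carrier →ₗ[ℂ] B →ₗ[ℂ] carrier
  rsmul_mul : ∀ x b c, rsmul x (b * c) = rsmul (rsmul x b) c
  /-- the `B`-valued inner product -/
  inner : carrier → carrier →ₗ[ℂ] B
  inner_rsmul : ∀ x y b, inner x (rsmul y b) = inner x y * b
  star_inner : ∀ x y, star (inner x y) = inner y x
  inner_self_pos : ∀ x, ∃ b, inner x x = star b * b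
  norm_sq : ∀ x, ‖x‖ ^ 2 = ‖inner x x‖
  /-- the left action `φ a x = a · x` -/
  φ : A →ₗ[ℂ] carrier →ₗ[ℂ] carrier
  φ_mul : ∀ a b x, φ (a * b) x = φ a (φ b x)
  inner_φ : ∀ a x y, inner (φ a x) y = inner x (φ (star a) y)

namespace Corr

instance (A B : Type u) [NonUnitalCStarAlgebra A] [NonUnitalCStarAlgebra B] :
    CoeSort (Corr A B) (Type u) := ⟨Corr.carrier⟩

attribute [instance] Corr.normedAddCommGroup Corr.normedSpace Corr.completeSpace

section Basic

variable {A B : Type u} [NonUnitalCStarAlgebra A] [NonUnitalCStarAlgebra B] (E : Corr A B)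

/-- The closed linear span of `{φ a x}` is everything. -/
def IsNondegenerate : Prop :=
  Dense (Submodule.span ℂ {y : E | ∃ (a : A) (x : E), y = E.φ a x} : Set E)

/-- The range of the inner product generates `B` as a closed two-sided ideal.  (The linear span of
the range is already a two-sided ideal.) -/
def IsFull : Prop :=
  Dense (Submodule.span ℂ {b : B | ∃ x y : E, b = E.inner x y} : Set B)

/-- `T` lies in `𝒦(E)`, the closure in the operator norm of the linear span of the rank-one
operators `θ_{x,y} : z ↦ x · ⟨y, z⟩`. -/
def IsCompactOp (T : E →ₗ[ℂ] E) : Prop :=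
  ∀ ε : ℝ, 0 < ε → ∃ (n : ℕ) (x y : Fin n → E),
    ∀ z : E, ‖T z - ∑ i, E.rsmul (x i) (E.inner (y i) z)‖ ≤ ε * ‖z‖

end Basic

end Corr

section Semi

attribute [local instance] CStarAlgebra.spectralOrder CStarAlgebra.spectralOrderedRing

variable {B : Type u} [NonUnitalCStarAlgebra B] {V : Type u} [AddCommGroup V] [Module ℂ V]

/-- A positive semidefinite `B`-valued form on a complex vector space with a right `B`-action. -/
structure IsSemiInner (rs : V → B → V) (h : V → V →ₗ[ℂ] B) : Prop where
  rsmul : ∀ x y b, h x (rs y b) = h x y * b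
  symm : ∀ x y, star (h x y) = h y x
  pos : ∀ x, ∃ b, h x x = star b * b

variable {rs : V → B → V} {h : V → V →ₗ[ℂ] B}

lemma IsSemiInner.nonneg (H : IsSemiInner rs h) (x : V) : 0 ≤ h x x := by
  obtain ⟨b, hb⟩ := H.pos x
  rw [hb]; exact star_mul_self_nonneg b

lemma IsSemiInner.add_left (H : IsSemiInner rs h) (x y z : V) : h (x + y) z = h x z + h y z := by
  rw [← H.symm, map_add, star_add, H.symm, H.symm]

lemma IsSemiInner.sub_left (H : IsSemiInner rs h) (x y z : V) : h (x - y) z = h x z - h y z := by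
  rw [← H.symm, map_sub, star_sub, H.symm, H.symm]

lemma IsSemiInner.smul_left (H : IsSemiInner rs h) (c : ℂ) (x z : V) :
    h (c • x) z = star c • h x z := by
  rw [← H.symm, map_smul, star_smul, H.symm]

lemma IsSemiInner.rsmul_left (H : IsSemiInner rs h) (x y : V) (b : B) :
    h (rs x b) y = star b * h x y := by
  rw [← H.symm, H.rsmul, star_mul, H.symm]

lemma IsSemiInner.norm_le (H : IsSemiInner rs h) (x y : V) :
    ‖h x y‖ ≤ √‖h x x‖ * √‖h y y‖ := by
  have key : ∀ t : ℝ, ‖h x x‖ < t → ‖h x y‖ ^ 2 ≤ t * ‖h y y‖ := by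
    intro t ht
    have ht0 : 0 < t := (norm_nonneg _).trans_lt ht
    set b := h x y with hb
    have h1 : 0 ≤ h (rs x b - (t : ℂ) • y) (rs x b - (t : ℂ) • y) := H.nonneg _
    have e : h (rs x b - (t : ℂ) • y) (rs x b - (t : ℂ) • y)
        = star b * h x x * b - (2 * t) • (star b * b) + (t * t) • h y y := by
      rw [H.sub_left, map_sub, map_sub, H.rsmul, H.rsmul, H.rsmul_left, H.smul_left, H.smul_left,
        map_smul, map_smul, H.rsmul_left, ← H.symm x y, ← hb]
      simp only [Complex.star_def, Complex.conj_ofReal, Complex.coe_smul, smul_mul_assoc, smul_smul]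
      rw [two_mul, add_smul]
      abel
    have h2 : star b * h x x * b ≤ t • (star b * b) := by
      calc star b * h x x * b ≤ ‖h x x‖ • (star b * b) :=
            CStarAlgebra.star_left_conjugate_le_norm_smul (hb := .of_nonneg (H.nonneg x))
        _ ≤ t • (star b * b) := by
            have := star_mul_self_nonneg b
            gcongr
    have h3 : t • (star b * b) ≤ (t * t) • h y y := by
      rw [e] at h1
      have : (0 : B) ≤ t • (star b * b) - (2 * t) • (star b * b) + (t * t) • h y y :=
        h1.trans (by gcongr)
      rw [two_mul, add_smul] at this
      have h4 := add_le_add_left this (t • (star b * b))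
      simpa [sub_eq_add_neg, add_assoc, add_comm, add_left_comm] using h4
    have h5 : ‖t • (star b * b)‖ ≤ ‖(t * t) • h y y‖ :=
      CStarAlgebra.norm_le_norm_of_nonneg_of_le
        (smul_nonneg ht0.le (star_mul_self_nonneg b)) h3
    rw [norm_smul, norm_smul, CStarRing.norm_star_mul_self, Real.norm_of_nonneg ht0.le,
      Real.norm_of_nonneg (by positivity), mul_assoc] at h5
    rw [pow_two]
    exact le_of_mul_le_mul_left h5 ht0
  have k2 : ‖h x y‖ ^ 2 ≤ ‖h x x‖ * ‖h y y‖ := by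
    refine le_of_forall_pos_le_add fun ε hε => ?_
    have hp : 0 < ‖h y y‖ + 1 := by positivity
    refine (key (‖h x x‖ + ε / (‖h y y‖ + 1)) (by have : 0 < ε / (‖h y y‖ + 1) := by positivity
                                                  linarith)).trans ?_
    rw [add_mul]
    gcongr
    rw [div_mul_eq_mul_div, div_le_iff₀ hp]
    nlinarith
  rw [← Real.sqrt_mul (norm_nonneg _)]
  exact Real.le_sqrt_of_sq_le k2

lemma IsSemiInner.triangle (H : IsSemiInner rs h) (x y : V) :
    √‖h (x + y) (x + y)‖ ≤ √‖h x x‖ + √‖h y y‖ := by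
  have a := Real.sq_sqrt (norm_nonneg (h x x))
  have b := Real.sq_sqrt (norm_nonneg (h y y))
  have c := H.norm_le x y
  have d := H.norm_le y x
  refine Real.sqrt_le_iff.mpr ⟨by positivity, ?_⟩
  calc ‖h (x + y) (x + y)‖ = ‖(h x x + h x y) + (h y x + h y y)‖ := by
        rw [H.add_left, map_add, map_add]
    _ ≤ (‖h x x‖ + ‖h x y‖) + (‖h y x‖ + ‖h y y‖) :=
        (norm_add_le _ _).trans (add_le_add (norm_add_le _ _) (norm_add_le _ _))
    _ ≤ _ := by nlinarith

end Semi

section C0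

variable {V : Type u} (A : V → Type u) [∀ v, NonUnitalCStarAlgebra (A v)]

/-- The `c₀`-direct sum of a family of `C*`-algebras, inside the `ℓ^∞`-direct sum. -/
def c0Sub : NonUnitalStarSubalgebra ℂ (lp A ∞) where
  carrier := {f | Tendsto (fun v => ‖f v‖) cofinite (𝓝 0)}
  zero_mem' := by
    have : Tendsto (fun _ : V => (0 : ℝ)) cofinite (𝓝 0) := tendsto_const_nhds
    simpa using this
  add_mem' {f g} hf hg := by
    refine squeeze_zero (fun _ => norm_nonneg _) (fun v => ?_) (by simpa using Tendsto.add hf hg)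
    exact norm_add_le _ _
  mul_mem' {f g} hf hg := by
    refine squeeze_zero (fun _ => norm_nonneg _) (fun v => ?_) (by simpa using Tendsto.mul hf hg)
    exact norm_mul_le _ _
  smul_mem' c f hf := by
    have : Tendsto (fun v => ‖c‖ * ‖f v‖) cofinite (𝓝 0) := by simpa using Tendsto.const_mul ‖c‖ hf
    refine squeeze_zero (fun _ => norm_nonneg _) (fun v => ?_) this
    simp [norm_smul]
  star_mem' {f} hf := by
    simpa using hf

/-- The `C*`-algebra `⨁ᵥ Aᵥ` (`c₀`-direct sum). -/
def C0Sum : Type u := c0Sub A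

instance c0Sub_isClosed : IsClosed (c0Sub A : Set (lp A ∞)) := by
  refine isClosed_of_closure_subset fun f hf => ?_
  rw [Metric.mem_closure_iff] at hf
  refine Metric.tendsto_nhds.mpr fun ε hε => ?_
  obtain ⟨g, hg, hfg⟩ := hf (ε / 2) (by positivity)
  filter_upwards [Metric.tendsto_nhds.mp hg (ε / 2) (by positivity)] with v hv
  have h1 : ‖(f - g) v‖ ≤ ‖f - g‖ := lp.norm_apply_le_norm ENNReal.top_ne_zero _ _
  rw [dist_eq_norm] at hfg
  simp only [dist_zero_right, norm_norm] at hv ⊢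
  have h2 : ‖f v‖ ≤ ‖(f - g) v‖ + ‖g v‖ := by
    have : f v = (f - g) v + g v := by simp
    rw [this]; exact norm_add_le _ _
  linarith

instance : NonUnitalCStarAlgebra (C0Sum A) :=
  NonUnitalStarSubalgebra.nonUnitalCStarAlgebra (c0Sub A)

variable {A}

/-- The `v`-component of an element of `⨁ᵥ Aᵥ`. -/
def C0Sum.eval (v : V) : C0Sum A →⋆ₙₐ[ℂ] A v where
  toFun a := a.1 v
  map_smul' _ _ := rfl
  map_zero' := rfl
  map_add' _ _ := rfl
  map_mul' _ _ := rfl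
  map_star' _ := rfl

@[ext] lemma C0Sum.ext {a b : C0Sum A} (h : ∀ v, C0Sum.eval v a = C0Sum.eval v b) : a = b :=
  Subtype.ext (lp.ext (funext h))

open Classical in
/-- The inclusion `Aᵥ → ⨁ᵥ Aᵥ`. -/
def C0Sum.single (v : V) : A v →⋆ₙₐ[ℂ] C0Sum A where
  toFun a := ⟨lp.single ∞ v a, by
    refine tendsto_const_nhds.congr' (f₁ := fun _ => (0 : ℝ)) ?_
    filter_upwards [(Set.finite_singleton v).compl_mem_cofinite] with w hw
    rw [lp.single_apply_ne _ _ _ (by simpa using hw), norm_zero]⟩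
  map_smul' c a := Subtype.ext (lp.single_smul ∞ v c a)
  map_zero' := Subtype.ext (lp.single_zero ∞ v)
  map_add' a b := Subtype.ext (lp.single_add ∞ v a b)
  map_mul' a b := by
    refine Subtype.ext (lp.ext (funext fun w => ?_))
    change (lp.single ∞ v (a * b) : lp A ∞) w = lp.single ∞ v a w * lp.single ∞ v b w
    by_cases hw : w = v
    · subst hw; simp
    · simp [hw]
  map_star' a := by
    refine Subtype.ext (lp.ext (funext fun w => ?_))
    change (lp.single ∞ v (star a) : lp A ∞) w = star (lp.single ∞ v a w)
    by_cases hw : w = v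
    · subst hw; simp
    · simp [hw]

lemma C0Sum.eval_single_same (v : V) (a : A v) : C0Sum.eval v (C0Sum.single v a) = a := by
  classical
  exact lp.single_apply_self (E := A) ∞ v a

lemma C0Sum.eval_single_ne {v w : V} (h : w ≠ v) (a : A v) :
    C0Sum.eval w (C0Sum.single v a) = 0 := by
  classical
  exact lp.single_apply_ne (E := A) ∞ v a h

lemma C0Sum.single_mul (v : V) (a : A v) (b : C0Sum A) :
    C0Sum.single v a * b = C0Sum.single v (a * C0Sum.eval v b) := by
  ext w
  rw [map_mul]
  by_cases hw : w = v
  · subst hw; simp [C0Sum.eval_single_same]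
  · simp [C0Sum.eval_single_ne hw]

lemma C0Sum.norm_single (v : V) (a : A v) : ‖C0Sum.single v a‖ = ‖a‖ := by
  classical
  exact lp.norm_single (E := A) ENNReal.zero_lt_top v a

/-- `C0Sum.eval` as a linear map. -/
def C0Sum.evalₗ (v : V) : C0Sum A →ₗ[ℂ] A v where
  toFun := C0Sum.eval v
  map_add' := map_add _
  map_smul' := map_smul _

/-- `C0Sum.single` as a linear map. -/
def C0Sum.singleₗ (v : V) : A v →ₗ[ℂ] C0Sum A where
  toFun := C0Sum.single v
  map_add' := map_add _
  map_smul' := map_smul _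

@[simp] lemma C0Sum.evalₗ_apply (v : V) (a : C0Sum A) : C0Sum.evalₗ v a = C0Sum.eval v a := rfl

@[simp] lemma C0Sum.singleₗ_apply (v : V) (a : A v) : C0Sum.singleₗ v a = C0Sum.single v a := rfl

/-- An `A_v`-`A_w` correspondence regarded as a correspondence over `⨁ᵥ Aᵥ`. -/
def Corr.inflate {v w : V} (E : Corr (A v) (A w)) : Corr (C0Sum A) (C0Sum A) where
  carrier := E
  rsmul := E.rsmul.compl₂ (C0Sum.evalₗ w)
  rsmul_mul x b c := by simp [E.rsmul_mul]
  inner x := C0Sum.singleₗ w ∘ₗ E.inner x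
  inner_rsmul x y b := by
    simp only [LinearMap.coe_comp, Function.comp_apply, LinearMap.compl₂_apply,
      C0Sum.singleₗ_apply, C0Sum.evalₗ_apply, E.inner_rsmul, C0Sum.single_mul]
  star_inner x y := by simp [← map_star, E.star_inner]
  inner_self_pos x := by
    obtain ⟨b, hb⟩ := E.inner_self_pos x
    exact ⟨C0Sum.single w b, by simp [hb, ← map_star]⟩
  norm_sq x := by
    rw [E.norm_sq]; exact (C0Sum.norm_single w _).symm
  φ := E.φ ∘ₗ C0Sum.evalₗ v
  φ_mul a b x := by simp [E.φ_mul]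
  inner_φ a x y := by
    simp only [LinearMap.coe_comp, Function.comp_apply, C0Sum.singleₗ_apply, C0Sum.evalₗ_apply,
      E.inner_φ, map_star]

end C0

namespace Corr

section Lemmas

attribute [local instance] CStarAlgebra.spectralOrder CStarAlgebra.spectralOrderedRing

variable {A B : Type u} [NonUnitalCStarAlgebra A] [NonUnitalCStarAlgebra B] (E : Corr A B)

lemma isSemiInner : IsSemiInner (fun x b => E.rsmul x b) E.inner :=
  ⟨E.inner_rsmul, E.star_inner, E.inner_self_pos⟩

lemma norm_eq (x : E) : ‖x‖ = √‖E.inner x x‖ := by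
  rw [← E.norm_sq, Real.sqrt_sq (norm_nonneg _)]

lemma inner_φ_self_le (a : A) (x : E) :
    E.inner (E.φ a x) (E.φ a x) ≤ (‖a‖ ^ 2) • E.inner x x := by
  have h0 := CStarAlgebra.star_mul_le_algebraMap_norm_sq (a := (a : Unitization ℂ A))
  rw [← sub_nonneg, CStarAlgebra.nonneg_iff_eq_star_mul_self] at h0
  obtain ⟨c, hc⟩ := h0
  have h1 := congrArg (fun z => z.fst) hc
  have h2 := congrArg (fun z => z.snd) hc
  rw [Unitization.norm_inr, IsScalarTower.algebraMap_apply ℝ ℂ (Unitization ℂ A)] at h1 h2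
  simp only [Unitization.algebraMap_eq_inl, sub_eq_add_neg, Unitization.fst_add, Unitization.fst_neg,
    Unitization.fst_mul,
    Unitization.fst_star, Unitization.fst_inr, Unitization.snd_add, Unitization.snd_neg, Unitization.snd_mul,
    Unitization.snd_star, Unitization.snd_inr, Unitization.fst_inl, Unitization.snd_inl,
    Complex.coe_algebraMap, star_zero, zero_smul, zero_add, mul_zero, neg_zero,
    add_zero] at h1 h2
  rw [← sub_nonneg]
  have e : (‖a‖ ^ 2) • E.inner x x - E.inner (E.φ a x) (E.φ a x)
      = E.inner (c.fst • x + E.φ c.snd x) (c.fst • x + E.φ c.snd x) := by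
    have e1 : (‖a‖ ^ 2) • E.inner x x = (star c.fst * c.fst) • E.inner x x := by
      rw [← h1, Complex.coe_smul]
    have e2 : E.inner (E.φ a x) (E.φ a x) = - E.inner x (E.φ (-(star a * a)) x) := by
      rw [E.inner_φ, ← E.φ_mul, map_neg, LinearMap.neg_apply, map_neg, neg_neg]
    rw [e1, e2, sub_neg_eq_add, h2, E.isSemiInner.add_left, E.isSemiInner.smul_left, E.inner_φ]
    simp only [map_add, map_smul, LinearMap.add_apply, LinearMap.smul_apply, E.φ_mul, smul_add,
      smul_smul]
    abel
  rw [e]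
  exact E.isSemiInner.nonneg _

end Lemmas

section L2

attribute [local instance] CStarAlgebra.spectralOrder CStarAlgebra.spectralOrderedRing

variable {A B : Type u} [NonUnitalCStarAlgebra A] [NonUnitalCStarAlgebra B]
  {I : Type u} (E : I → Corr A B)

/-- The partial inner product `∑_{i ∈ G} ⟨x i, y i⟩`. -/
def partialInner (G : Finset I) (x : ∀ i, E i) : (∀ i, E i) →ₗ[ℂ] B :=
  ∑ i ∈ G, (E i).inner (x i) ∘ₗ LinearMap.proj i

lemma partialInner_apply (G : Finset I) (x y : ∀ i, E i) :
    partialInner E G x y = ∑ i ∈ G, (E i).inner (x i) (y i) := by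
  simp [partialInner]

lemma partialInner_isSemiInner (G : Finset I) :
    IsSemiInner (fun (x : ∀ i, E i) (b : B) i => (E i).rsmul (x i) b) (partialInner E G) where
  rsmul x y b := by simp [partialInner_apply, (E _).inner_rsmul, Finset.sum_mul]
  symm x y := by simp [partialInner_apply, (E _).star_inner]
  pos x := by
    rw [← CStarAlgebra.nonneg_iff_eq_star_mul_self, partialInner_apply]
    exact Finset.sum_nonneg fun i _ => (E i).isSemiInner.nonneg _

/-- The seminorm `‖∑_{i ∈ G} ⟨x i, x i⟩‖^{1/2}`. -/
def partialNorm (G : Finset I) (x : ∀ i, E i) : ℝ := √‖partialInner E G x x‖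

lemma partialNorm_add (G : Finset I) (x y : ∀ i, E i) :
    partialNorm E G (x + y) ≤ partialNorm E G x + partialNorm E G y :=
  (partialInner_isSemiInner E G).triangle x y

lemma partialNorm_smul (G : Finset I) (c : ℂ) (x : ∀ i, E i) :
    partialNorm E G (c • x) = ‖c‖ * partialNorm E G x := by
  rw [partialNorm, (partialInner_isSemiInner E G).smul_left, map_smul, smul_smul, norm_smul,
    norm_mul, norm_star, Real.sqrt_mul (by positivity), Real.sqrt_mul_self (norm_nonneg _),
    partialNorm]

lemma partialNorm_le_sum (G : Finset I) (x : ∀ i, E i) :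
    partialNorm E G x ≤ ∑ i ∈ G, ‖x i‖ := by
  have h0 : 0 ≤ ∑ i ∈ G, ‖x i‖ := Finset.sum_nonneg fun i _ => norm_nonneg _
  refine Real.sqrt_le_iff.mpr ⟨h0, ?_⟩
  rw [partialInner_apply]
  refine (norm_sum_le _ _).trans ?_
  simp_rw [← (E _).norm_sq, pow_two, Finset.sum_mul]
  refine Finset.sum_le_sum fun i hi => ?_
  gcongr
  exact Finset.single_le_sum (f := fun i => ‖x i‖) (fun i _ => norm_nonneg _) hi

lemma partialNorm_φ_le (G : Finset I) (a : A) (x : ∀ i, E i) :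
    partialNorm E G (fun i => (E i).φ a (x i)) ≤ ‖a‖ * partialNorm E G x := by
  have h : partialInner E G (fun i => (E i).φ a (x i)) (fun i => (E i).φ a (x i))
      ≤ (‖a‖ ^ 2) • partialInner E G x x := by
    rw [partialInner_apply, partialInner_apply, Finset.smul_sum]
    exact Finset.sum_le_sum fun i _ => (E i).inner_φ_self_le a (x i)
  have h2 := CStarAlgebra.norm_le_norm_of_nonneg_of_le
    ((partialInner_isSemiInner E G).nonneg _) h
  rw [norm_smul, Real.norm_of_nonneg (by positivity)] at h2
  refine (Real.sqrt_le_sqrt h2).trans ?_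
  rw [Real.sqrt_mul (by positivity), Real.sqrt_sq (norm_nonneg _), partialNorm]

lemma partialNorm_rsmul_le (G : Finset I) (b : B) (x : ∀ i, E i) :
    partialNorm E G (fun i => (E i).rsmul (x i) b) ≤ ‖b‖ * partialNorm E G x := by
  have h : partialInner E G (fun i => (E i).rsmul (x i) b) (fun i => (E i).rsmul (x i) b)
      = star b * (partialInner E G x x * b) := by
    rw [(partialInner_isSemiInner E G).rsmul_left, (partialInner_isSemiInner E G).rsmul]
  refine Real.sqrt_le_iff.mpr ⟨by unfold partialNorm; positivity, ?_⟩
  rw [h, mul_pow, partialNorm, Real.sq_sqrt (norm_nonneg _)]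
  refine (norm_mul_le _ _).trans ?_
  rw [norm_star, pow_two, mul_assoc]
  gcongr
  rw [mul_comm ‖b‖]
  exact norm_mul_le _ _

lemma summable_iff_partialNorm (x : ∀ i, E i) :
    (Summable fun i => (E i).inner (x i) (x i)) ↔
      ∀ ε > 0, ∃ F : Finset I, ∀ G, Disjoint G F → partialNorm E G x < ε := by
  rw [summable_iff_vanishing_norm]
  constructor
  · intro h ε hε
    obtain ⟨F, hF⟩ := h (ε ^ 2) (by positivity)
    refine ⟨F, fun G hG => ?_⟩
    rw [partialNorm, Real.sqrt_lt' hε, partialInner_apply]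
    exact hF G hG
  · intro h ε hε
    obtain ⟨F, hF⟩ := h (√ε) (by positivity)
    refine ⟨F, fun G hG => ?_⟩
    have := hF G hG
    rw [partialNorm, Real.sqrt_lt_sqrt_iff (norm_nonneg _), partialInner_apply] at this
    exact this

/-- The families `(x i)` for which `∑ i, ⟨x i, x i⟩` converges in norm in `B`. -/
def l2Sub : Submodule ℂ (∀ i, E i) where
  carrier := {x | Summable fun i => (E i).inner (x i) (x i)}
  zero_mem' := by simp
  add_mem' {x y} hx hy := by
    classical
    rw [Set.mem_ofPred_eq, summable_iff_partialNorm] at *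
    intro ε hε
    obtain ⟨F, hF⟩ := hx (ε / 2) (by positivity)
    obtain ⟨F', hF'⟩ := hy (ε / 2) (by positivity)
    refine ⟨F ∪ F', fun G hG => ?_⟩
    rw [Finset.disjoint_union_right] at hG
    linarith [partialNorm_add E G x y, hF G hG.1, hF' G hG.2]
  smul_mem' c x hx := by
    rw [Set.mem_ofPred_eq, summable_iff_partialNorm] at *
    intro ε hε
    obtain ⟨F, hF⟩ := hx (ε / (‖c‖ + 1)) (by positivity)
    refine ⟨F, fun G hG => ?_⟩
    rw [partialNorm_smul]
    have h := hF G hG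
    rw [lt_div_iff₀ (by positivity)] at h
    have : 0 ≤ partialNorm E G x := Real.sqrt_nonneg _
    nlinarith

/-- The underlying space of the `ℓ²`-direct sum of the correspondences `E i`. -/
def L2Sum : Type u := l2Sub E

namespace L2Sum

instance : AddCommGroup (L2Sum E) := inferInstanceAs (AddCommGroup (l2Sub E))
instance : Module ℂ (L2Sum E) := inferInstanceAs (Module ℂ (l2Sub E))
instance : CoeFun (L2Sum E) (fun _ => ∀ i, E i) := ⟨fun x => x.1⟩

variable {E}

@[ext] lemma ext {x y : L2Sum E} (h : ∀ i, x i = y i) : x = y := Subtype.ext (funext h)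

@[simp] lemma add_apply (x y : L2Sum E) (i : I) : (x + y) i = x i + y i := rfl
@[simp] lemma sub_apply (x y : L2Sum E) (i : I) : (x - y) i = x i - y i := rfl
@[simp] lemma smul_apply (c : ℂ) (x : L2Sum E) (i : I) : (c • x) i = c • x i := rfl
@[simp] lemma zero_apply (i : I) : (0 : L2Sum E) i = 0 := rfl

lemma summable_inner (x y : L2Sum E) : Summable fun i => (E i).inner (x i) (y i) := by
  classical
  rw [summable_iff_vanishing_norm]
  intro ε hε
  obtain ⟨F, hF⟩ := (summable_iff_partialNorm E x).mp x.2 (√ε) (by positivity)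
  obtain ⟨F', hF'⟩ := (summable_iff_partialNorm E y).mp y.2 (√ε) (by positivity)
  refine ⟨F ∪ F', fun G hG => ?_⟩
  rw [Finset.disjoint_union_right] at hG
  rw [← partialInner_apply]
  have h1 := hF G hG.1
  have h2 := hF' G hG.2
  calc _ ≤ partialNorm E G x * partialNorm E G y := (partialInner_isSemiInner E G).norm_le _ _
    _ < √ε * √ε := mul_lt_mul'' h1 h2 (Real.sqrt_nonneg _) (Real.sqrt_nonneg _)
    _ = ε := Real.mul_self_sqrt hε.le

/-- The inner product `⟨x, y⟩ = ∑ i, ⟨x i, y i⟩`. -/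
def inner (x : L2Sum E) : L2Sum E →ₗ[ℂ] B where
  toFun y := ∑' i, (E i).inner (x i) (y i)
  map_add' y z := by
    simp only [add_apply, map_add]
    exact (summable_inner x y).tsum_add (summable_inner x z)
  map_smul' c y := by
    simp only [smul_apply, map_smul, RingHom.id_apply]
    exact (summable_inner x y).tsum_const_smul c

lemma hasSum_inner (x y : L2Sum E) : HasSum (fun i => (E i).inner (x i) (y i)) (inner x y) :=
  (summable_inner x y).hasSum

/-- The right action, componentwise. -/
def rsmul : L2Sum E →ₗ[ℂ] B →ₗ[ℂ] L2Sum E :=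
  LinearMap.mk₂ ℂ (fun x b => ⟨fun i => (E i).rsmul (x i) b, by
      change Summable _
      rw [summable_iff_partialNorm]
      intro ε hε
      obtain ⟨F, hF⟩ := (summable_iff_partialNorm E x).mp x.2 (ε / (‖b‖ + 1)) (by positivity)
      refine ⟨F, fun G hG => (partialNorm_rsmul_le E G b x).trans_lt ?_⟩
      have h := hF G hG
      rw [lt_div_iff₀ (by positivity)] at h
      have : 0 ≤ partialNorm E G x := Real.sqrt_nonneg _
      nlinarith⟩)
    (fun x y b => by ext i; simp; rfl) (fun c x b => by ext i; simp; rfl)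
    (fun x b c => by ext i; simp; rfl) (fun c x b => by ext i; simp; rfl)

/-- The left action, componentwise. -/
def φ : A →ₗ[ℂ] L2Sum E →ₗ[ℂ] L2Sum E :=
  LinearMap.mk₂ ℂ (fun a x => ⟨fun i => (E i).φ a (x i), by
      change Summable _
      rw [summable_iff_partialNorm]
      intro ε hε
      obtain ⟨F, hF⟩ := (summable_iff_partialNorm E x).mp x.2 (ε / (‖a‖ + 1)) (by positivity)
      refine ⟨F, fun G hG => (partialNorm_φ_le E G a x).trans_lt ?_⟩
      have h := hF G hG
      rw [lt_div_iff₀ (by positivity)] at h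
      have : 0 ≤ partialNorm E G x := Real.sqrt_nonneg _
      nlinarith⟩)
    (fun x y b => by ext i; simp; rfl) (fun c x b => by ext i; simp; rfl)
    (fun x b c => by ext i; simp; rfl) (fun c x b => by ext i; simp; rfl)

@[simp] lemma rsmul_apply (x : L2Sum E) (b : B) (i : I) : rsmul x b i = (E i).rsmul (x i) b := rfl
@[simp] lemma φ_apply (a : A) (x : L2Sum E) (i : I) : φ a x i = (E i).φ a (x i) := rfl

lemma nonneg_of_hasSum {J : Type u} {f : J → B} {b : B} (h : HasSum f b) (hf : ∀ i, 0 ≤ f i) :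
    0 ≤ b :=
  CStarAlgebra.isClosed_nonneg.mem_of_tendsto h
    (Eventually.of_forall fun _ => Finset.sum_nonneg fun i _ => hf i)

lemma isSemiInner : IsSemiInner (fun (x : L2Sum E) (b : B) => rsmul x b) inner where
  rsmul x y b := by
    refine HasSum.unique (hasSum_inner x (rsmul y b)) ?_
    simpa only [rsmul_apply, (E _).inner_rsmul] using (hasSum_inner x y).mul_right b
  symm x y := by
    refine HasSum.unique ?_ (hasSum_inner y x)
    simpa only [(E _).star_inner] using (hasSum_inner x y).star
  pos x := by
    rw [← CStarAlgebra.nonneg_iff_eq_star_mul_self]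
    exact nonneg_of_hasSum (hasSum_inner x x) fun i => (E i).isSemiInner.nonneg _

instance : Norm (L2Sum E) := ⟨fun x => √‖inner x x‖⟩

lemma norm_def (x : L2Sum E) : ‖x‖ = √‖inner x x‖ := rfl

lemma tendsto_partialNorm (x : L2Sum E) :
    Tendsto (fun G => partialNorm E G x) atTop (𝓝 ‖x‖) := by
  have := (hasSum_inner x x).norm.sqrt
  refine this.congr fun G => ?_
  rw [partialNorm, partialInner_apply]

lemma sum_le_inner (x : L2Sum E) (G : Finset I) :
    partialInner E G x x ≤ inner x x := by
  rw [← sub_nonneg]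
  refine CStarAlgebra.isClosed_nonneg.mem_of_tendsto
    (Tendsto.sub (hasSum_inner x x) tendsto_const_nhds) ?_
  filter_upwards [eventually_ge_atTop G] with G' hG'
  rw [sub_nonneg, partialInner_apply]
  exact Finset.sum_le_sum_of_subset_of_nonneg hG' fun i _ _ => (E i).isSemiInner.nonneg _

lemma partialNorm_le (x : L2Sum E) (G : Finset I) : partialNorm E G x ≤ ‖x‖ :=
  Real.sqrt_le_sqrt (CStarAlgebra.norm_le_norm_of_nonneg_of_le
    ((partialInner_isSemiInner E G).nonneg _) (sum_le_inner x G))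

lemma norm_apply_le (x : L2Sum E) (i : I) : ‖x i‖ ≤ ‖x‖ := by
  refine le_trans (le_of_eq ?_) (partialNorm_le x {i})
  rw [partialNorm, partialInner_apply, Finset.sum_singleton, ← (E i).norm_eq]

lemma core : NormedSpace.Core ℂ (L2Sum E) where
  norm_nonneg x := Real.sqrt_nonneg _
  norm_smul c x := by
    rw [norm_def, isSemiInner.smul_left, map_smul, smul_smul, norm_smul,
      norm_mul, norm_star, Real.sqrt_mul (by positivity), Real.sqrt_mul_self (norm_nonneg _),
      norm_def]
  norm_triangle x y := isSemiInner.triangle x y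
  norm_eq_zero_iff x := by
    constructor
    · intro h
      ext i
      have := norm_apply_le x i
      rw [h] at this
      simpa using this
    · rintro rfl
      simp [norm_def]

instance : NormedAddCommGroup (L2Sum E) := NormedAddCommGroup.ofCore core
instance : NormedSpace ℂ (L2Sum E) := NormedSpace.ofCore core

instance : CompleteSpace (L2Sum E) := by
  refine Metric.complete_of_cauchySeq_tendsto fun s hs => ?_
  have hc : ∀ i, CauchySeq fun n => s n i := by
    intro i
    rw [Metric.cauchySeq_iff'] at hs ⊢
    intro ε hε
    obtain ⟨N, hN⟩ := hs ε hε
    refine ⟨N, fun n hn => lt_of_le_of_lt ?_ (hN n hn)⟩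
    rw [dist_eq_norm, dist_eq_norm]
    exact norm_apply_le (s n - s N) i
  choose y hy using fun i => cauchySeq_tendsto_of_complete (hc i)
  have hest : ∀ ε > 0, ∃ N, ∀ n ≥ N, ∀ G, partialNorm E G ((s n : ∀ i, E i) - y) ≤ ε := by
    intro ε hε
    obtain ⟨N, hN⟩ := Metric.cauchySeq_iff.mp hs ε hε
    refine ⟨N, fun n hn G => ?_⟩
    have hlim : Tendsto (fun m => ε + ∑ i ∈ G, ‖s m i - y i‖) atTop (𝓝 (ε + ∑ _i ∈ G, 0)) := by
      refine tendsto_const_nhds.add (tendsto_finsetSum _ fun i _ => ?_)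
      exact tendsto_iff_norm_sub_tendsto_zero.mp (hy i)
    rw [Finset.sum_const_zero, add_zero] at hlim
    refine ge_of_tendsto hlim ?_
    filter_upwards [eventually_ge_atTop N] with m hm
    have e : ((s n : ∀ i, E i) - y) = ((s n - s m : L2Sum E) : ∀ i, E i) + (fun i => s m i - y i) := by
      funext i; simp
    rw [e]
    refine (partialNorm_add E G _ _).trans (add_le_add ?_ (partialNorm_le_sum E G _))
    refine (partialNorm_le _ G).trans ?_
    rw [← dist_eq_norm]
    exact (hN n hn m hm).le
  have hmem : y ∈ l2Sub E := by
    change Summable _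
    rw [summable_iff_partialNorm]
    intro ε hε
    obtain ⟨N, hN⟩ := hest (ε / 2) (by positivity)
    obtain ⟨F, hF⟩ := (summable_iff_partialNorm E (s N)).mp (s N).2 (ε / 2) (by positivity)
    refine ⟨F, fun G hG => ?_⟩
    have e : y = (s N : ∀ i, E i) + (-1 : ℂ) • ((s N : ∀ i, E i) - y) := by
      funext i; simp
    rw [e]
    have h1 := partialNorm_add E G (s N : ∀ i, E i) ((-1 : ℂ) • ((s N : ∀ i, E i) - y))
    rw [partialNorm_smul, norm_neg, norm_one, one_mul] at h1
    linarith [hN N le_rfl G, hF G hG]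
  let z : L2Sum E := ⟨y, hmem⟩
  refine ⟨z, Metric.tendsto_atTop.mpr fun ε hε => ?_⟩
  obtain ⟨N, hN⟩ := hest (ε / 2) (by positivity)
  refine ⟨N, fun n hn => ?_⟩
  rw [dist_eq_norm]
  refine lt_of_le_of_lt (le_of_tendsto (tendsto_partialNorm _) ?_) (half_lt_self hε)
  exact Eventually.of_forall fun G => hN n hn G

open Classical in
/-- The inclusion of the `i`-th summand. -/
def single (i : I) : E i →ₗ[ℂ] L2Sum E where
  toFun x := ⟨Pi.single i x, by
    refine summable_of_ne_finset_zero (s := {i}) fun j hj => ?_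
    rw [Pi.single_eq_of_ne (by simpa using hj), map_zero]⟩
  map_add' x y := Subtype.ext (Pi.single_add (f := fun i => (E i).carrier) i x y)
  map_smul' c x := Subtype.ext (Pi.single_smul (f := fun i => (E i).carrier) i c x)

@[simp] lemma single_same (i : I) (x : E i) : single i x i = x := by
  classical
  exact Pi.single_eq_same (M := fun i => (E i).carrier) i x

lemma single_ne {i j : I} (h : j ≠ i) (x : E i) : single i x j = 0 := by
  classical
  exact Pi.single_eq_of_ne (M := fun i => (E i).carrier) h x

lemma norm_single (i : I) (x : E i) : ‖single i x‖ = ‖x‖ := by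
  rw [norm_def, (E i).norm_eq]
  congr 2
  refine HasSum.unique (hasSum_inner _ _) ?_
  have := hasSum_single (f := fun j => (E j).inner (single i x j) (single i x j)) i
    (fun j hj => by rw [single_ne hj, map_zero])
  simpa using this

lemma sum_single_apply (G : Finset I) (y : ∀ i, E i) (j : I) [Decidable (j ∈ G)] :
    (∑ i ∈ G, single i (y i)) j = if j ∈ G then y j else 0 := by
  classical
  have h : ∀ G : Finset I, (∑ i ∈ G, single i (y i)) j = ∑ i ∈ G, single i (y i) j := by
    intro G
    induction G using Finset.induction_on with
    | empty => simp
    | insert a s ha ih => rw [Finset.sum_insert ha, Finset.sum_insert ha, add_apply, ih]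
  rw [h]
  split_ifs with hj
  · rw [Finset.sum_eq_single j (fun i _ hi => single_ne hi.symm _) (fun h => absurd hj h),
      single_same]
  · refine Finset.sum_eq_zero fun i hi => single_ne ?_ _
    rintro rfl
    exact hj hi

lemma hasSum_single_apply (y : L2Sum E) : HasSum (fun i => single i (y i)) y := by
  classical
  refine Metric.tendsto_atTop.mpr fun ε hε => ?_
  obtain ⟨F, hF⟩ := (summable_iff_partialNorm E y).mp y.2 (ε / 2) (by positivity)
  refine ⟨F, fun G hG => ?_⟩
  rw [dist_comm, dist_eq_norm]
  refine lt_of_le_of_lt (le_of_tendsto (tendsto_partialNorm _) ?_) (half_lt_self hε)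
  refine Eventually.of_forall fun G' => le_trans (le_of_eq ?_)
    (hF (G' \ G) (Finset.disjoint_of_subset_right hG Finset.sdiff_disjoint)).le
  rw [partialNorm, partialNorm]
  congr 2
  rw [partialInner_apply, partialInner_apply, Finset.sdiff_eq_filter, Finset.sum_filter]
  refine Finset.sum_congr rfl fun j _ => ?_
  rw [sub_apply, sum_single_apply]
  split_ifs <;> simp_all

/-- A submodule whose closure contains every summand is dense. -/
lemma dense_of_single (S : Submodule ℂ (L2Sum E))
    (h : ∀ i x, single i x ∈ closure (S : Set (L2Sum E))) : Dense (S : Set (L2Sum E)) := by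
  intro y
  rw [← S.topologicalClosure_coe] at h ⊢
  exact S.isClosed_topologicalClosure.mem_of_tendsto (hasSum_single_apply y)
    (Eventually.of_forall fun G => S.topologicalClosure.sum_mem fun i _ => h i _)

end L2Sum

/-- The `ℓ²`-direct sum of a family of correspondences from `A` to `B`. -/
def l2Sum : Corr A B where
  carrier := L2Sum E
  rsmul := L2Sum.rsmul
  rsmul_mul x b c := by
    ext i
    exact (E i).rsmul_mul _ _ _
  inner := L2Sum.inner
  inner_rsmul := L2Sum.isSemiInner.rsmul
  star_inner := L2Sum.isSemiInner.symm
  inner_self_pos := L2Sum.isSemiInner.pos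
  norm_sq x := by
    rw [L2Sum.norm_def, Real.sq_sqrt (norm_nonneg _)]
  φ := L2Sum.φ
  φ_mul a b x := by
    ext i
    exact (E i).φ_mul _ _ _
  inner_φ a x y := by
    refine HasSum.unique (L2Sum.hasSum_inner _ _) ?_
    simpa only [L2Sum.φ_apply, (E _).inner_φ] using L2Sum.hasSum_inner x (L2Sum.φ (star a) y)

end L2

section Tensor

attribute [local instance] CStarAlgebra.spectralOrder CStarAlgebra.spectralOrderedRing

variable {A B C : Type u} [NonUnitalCStarAlgebra A] [NonUnitalCStarAlgebra B]
  [NonUnitalCStarAlgebra C]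

lemma inner_φ_mono (F : Corr B C) (y : F) {b b' : B} (h : b ≤ b') :
    F.inner y (F.φ b y) ≤ F.inner y (F.φ b' y) := by
  rw [← sub_nonneg] at h ⊢
  obtain ⟨c, hc⟩ := CStarAlgebra.nonneg_iff_eq_star_mul_self.mp h
  have : F.inner y (F.φ b' y) - F.inner y (F.φ b y) = F.inner (F.φ c y) (F.φ c y) := by
    rw [F.inner_φ, ← F.φ_mul, ← hc, map_sub, LinearMap.sub_apply, map_sub]
  rw [this]
  exact F.isSemiInner.nonneg _

lemma norm_φ_le (F : Corr B C) (b : B) (y : F) : ‖F.φ b y‖ ≤ ‖b‖ * ‖y‖ := by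
  have h := CStarAlgebra.norm_le_norm_of_nonneg_of_le
    (F.isSemiInner.nonneg _) (F.inner_φ_self_le b y)
  rw [norm_smul, ← F.norm_sq, ← F.norm_sq, Real.norm_of_nonneg (by positivity), ← mul_pow] at h
  exact le_of_sq_le_sq h (by positivity)

lemma tendsto_inner_φ (F : Corr B C) (y : F) {J : Type u} {l : Filter J} {s : J → B} {b : B}
    (h : Tendsto s l (𝓝 b)) :
    Tendsto (fun j => F.inner y (F.φ (s j) y)) l (𝓝 (F.inner y (F.φ b y))) := by
  rw [tendsto_iff_norm_sub_tendsto_zero] at h ⊢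
  have h2 : Tendsto (fun j => ‖y‖ * (‖s j - b‖ * ‖y‖)) l (𝓝 0) := by
    simpa using (h.mul_const ‖y‖).const_mul ‖y‖
  refine squeeze_zero (fun _ => norm_nonneg _) (fun j => ?_) h2
  rw [← map_sub, ← LinearMap.sub_apply, ← map_sub]
  refine (F.isSemiInner.norm_le _ _).trans ?_
  rw [← F.norm_eq, ← F.norm_eq]
  gcongr
  exact F.norm_φ_le _ _

lemma hasSum_of_nonneg {J : Type u} {f : J → C} {L : C} (h0 : ∀ j, 0 ≤ f j)
    (hle : ∀ G : Finset J, ∑ j ∈ G, f j ≤ L)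
    (happ : ∀ ε > 0, ∃ G : Finset J, ‖L - ∑ j ∈ G, f j‖ < ε) : HasSum f L := by
  classical
  refine Metric.tendsto_atTop.mpr fun ε hε => ?_
  obtain ⟨G, hG⟩ := happ ε hε
  refine ⟨G, fun G' hG' => ?_⟩
  rw [dist_comm, dist_eq_norm]
  refine lt_of_le_of_lt (CStarAlgebra.norm_le_norm_of_nonneg_of_le (sub_nonneg.mpr (hle G')) ?_) hG
  exact sub_le_sub_left (Finset.sum_le_sum_of_subset_of_nonneg hG' fun i _ _ => h0 i) _

/-- The inner product of a (formal) elementary tensor of two elements of `ℓ²`-direct sums. -/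
lemma hasSum_tensor {I J : Type u} {E : I → Corr A B} {F : J → Corr B C}
    (x : L2Sum E) (y : L2Sum F) :
    HasSum (fun p : I × J => (F p.2).inner (y p.2) ((F p.2).φ ((E p.1).inner (x p.1) (x p.1))
      (y p.2))) (L2Sum.inner y (L2Sum.φ (L2Sum.inner x x) y)) := by
  classical
  set t : I × J → C := fun p => (F p.2).inner (y p.2) ((F p.2).φ ((E p.1).inner (x p.1) (x p.1))
      (y p.2)) with ht
  set S := L2Sum.inner x x
  have hpos : ∀ (j : J) (b : B), 0 ≤ b → 0 ≤ (F j).inner (y j) ((F j).φ b (y j)) := by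
    intro j b hb
    have := (F j).inner_φ_mono (y j) hb
    rwa [map_zero, LinearMap.zero_apply, map_zero] at this
  have ht0 : ∀ p, 0 ≤ t p := fun p => hpos _ _ ((E p.1).isSemiInner.nonneg _)
  have hprod : ∀ (P : Finset I) (Q : Finset J), ∑ p ∈ P ×ˢ Q, t p
      = ∑ j ∈ Q, (F j).inner (y j) ((F j).φ (partialInner E P x x) (y j)) := by
    intro P Q
    rw [Finset.sum_product_right]
    refine Finset.sum_congr rfl fun j _ => ?_
    simp [ht, partialInner_apply]
  have hS : 0 ≤ S := L2Sum.isSemiInner.nonneg x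
  have hL : HasSum (fun j => (F j).inner (y j) ((F j).φ S (y j))) (L2Sum.inner y (L2Sum.φ S y)) :=
    L2Sum.hasSum_inner y (L2Sum.φ S y)
  refine hasSum_of_nonneg ht0 (fun G => ?_) (fun ε hε => ?_)
  · calc ∑ p ∈ G, t p ≤ ∑ p ∈ (G.image Prod.fst) ×ˢ (G.image Prod.snd), t p :=
          Finset.sum_le_sum_of_subset_of_nonneg Finset.subset_product fun i _ _ => ht0 i
      _ = _ := hprod _ _
      _ ≤ ∑ j ∈ G.image Prod.snd, (F j).inner (y j) ((F j).φ S (y j)) :=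
          Finset.sum_le_sum fun j _ => (F j).inner_φ_mono _ (L2Sum.sum_le_inner x _)
      _ ≤ _ := by
          rw [← sub_nonneg]
          refine CStarAlgebra.isClosed_nonneg.mem_of_tendsto
            (Tendsto.sub hL tendsto_const_nhds) ?_
          filter_upwards [eventually_ge_atTop (G.image Prod.snd)] with G' hG'
          rw [sub_nonneg]
          exact Finset.sum_le_sum_of_subset_of_nonneg hG' fun i _ _ => hpos _ _ hS
  · obtain ⟨Q, hQ⟩ := (Metric.tendsto_atTop.mp hL) (ε / 2) (by positivity)
    have hQ := hQ Q le_rfl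
    have h1 : Tendsto (fun P => ∑ p ∈ P ×ˢ Q, t p) atTop
        (𝓝 (∑ j ∈ Q, (F j).inner (y j) ((F j).φ S (y j)))) := by
      simp_rw [hprod]
      refine tendsto_finsetSum _ fun j _ => (F j).tendsto_inner_φ (y j) ?_
      exact (L2Sum.hasSum_inner x x).congr fun P => (partialInner_apply E P x x).symm
    obtain ⟨P, hP⟩ := (Metric.tendsto_atTop.mp h1) (ε / 2) (by positivity)
    refine ⟨P ×ˢ Q, ?_⟩
    have hP := hP P le_rfl
    rw [← dist_eq_norm, dist_comm]
    linarith [dist_triangle (∑ p ∈ P ×ˢ Q, t p)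
      (∑ j ∈ Q, (F j).inner (y j) ((F j).φ S (y j))) (L2Sum.inner y (L2Sum.φ S y))]

/-- Polarisation: a sesquilinear map that vanishes on the diagonal is zero. -/
lemma polarisation {V W : Type u} [AddCommGroup V] [Module ℂ V] [AddCommGroup W] [Module ℂ W]
    (D : V → V →ₗ[ℂ] W) (hadd : ∀ x y z, D (x + y) z = D x z + D y z)
    (hsmul : ∀ (c : ℂ) x z, D (c • x) z = star c • D x z) (h0 : ∀ x, D x x = 0) (x y : V) :
    D x y = 0 := by
  have h1 := h0 (x + y)
  rw [hadd, map_add, map_add, h0, h0, zero_add, add_zero] at h1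
  have h2 := h0 (x + Complex.I • y)
  rw [hadd, map_add, map_add, h0, hsmul, hsmul, map_smul, map_smul, h0, zero_add, smul_zero,
    smul_zero, add_zero] at h2
  have h3 : Complex.I • (D x y - D y x) = 0 := by
    rw [smul_sub, ← h2]
    simp [sub_eq_add_neg]
  rw [smul_eq_zero_iff_right Complex.I_ne_zero, sub_eq_zero] at h3
  rw [← h3, ← two_smul ℂ] at h1
  simpa using h1

end Tensor
end Corr

/-- An inner-product preserving map of correspondences `E ⊗_B F → G`, given by its values
`m x y` on elementary tensors `x ⊗ y`.

The internal tensor product `E ⊗_B F` is the Hausdorff completion of the algebraic tensor product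
for `⟨x ⊗ y, x' ⊗ y'⟩ = ⟨y, φ(⟨x, x'⟩) y'⟩`, with the actions `a · (x ⊗ y) = (a · x) ⊗ y` and
`(x ⊗ y) · c = x ⊗ (y · c)`; so a bilinear map `m` with the three properties below is the same
thing as a linear map `E ⊗_B F → G` that preserves inner products and both actions. (That `m` is
balanced over `B` follows from `inner_map`.) -/
structure Corr.IsTensorMap {A B C : Type u} [NonUnitalCStarAlgebra A] [NonUnitalCStarAlgebra B]
    [NonUnitalCStarAlgebra C] {E : Corr A B} {F : Corr B C} {G : Corr A C}
    (m : E →ₗ[ℂ] F →ₗ[ℂ] G) : Prop where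
  map_φ : ∀ a x y, m (E.φ a x) y = G.φ a (m x y)
  map_rsmul : ∀ x y c, m x (F.rsmul y c) = G.rsmul (m x y) c
  inner_map : ∀ x y x' y', G.inner (m x y) (m x' y') = F.inner y (F.φ (E.inner x x') y')

/-- The map `E ⊗_B F → G` with values `m x y` on elementary tensors is an isomorphism of
correspondences.  As it is isometric, it is surjective if and only if the linear span of the
elements `m x y` is dense. -/
structure Corr.IsTensorIso {A B C : Type u} [NonUnitalCStarAlgebra A] [NonUnitalCStarAlgebra B]
    [NonUnitalCStarAlgebra C] {E : Corr A B} {F : Corr B C} {G : Corr A C}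
    (m : E →ₗ[ℂ] F →ₗ[ℂ] G) : Prop extends Corr.IsTensorMap m where
  dense : Dense (Submodule.span ℂ {z : G | ∃ x y, z = m x y} : Set G)

/-- `j` is an isomorphism from the identity correspondence `A` (with `⟨a, b⟩ = a* b` and with
multiplication in `A` as left and right action) onto `E`. -/
structure Corr.IsIdentity {A : Type u} [NonUnitalCStarAlgebra A] (E : Corr A A)
    (j : A →ₗ[ℂ] E) : Prop where
  surjective : Function.Surjective j
  inner_map : ∀ a b, E.inner (j a) (j b) = star a * b
  φ_map : ∀ a b, E.φ a (j b) = j (a * b)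
  rsmul_map : ∀ a b, E.rsmul (j a) b = j (a * b)

/-- A product system over `P` of correspondences over `A`.  The semigroup is the disjoint union
`Σ p, Y p`.  The identity fibre is identified with the identity correspondence `A` through
`unit`. -/
structure ProductSystem (P : Type) [AddMonoid P] (A : Type u) [NonUnitalCStarAlgebra A] where
  Y : P → Corr A A
  mul : ∀ p q, Y p →ₗ[ℂ] Y q →ₗ[ℂ] Y (p + q)
  mul_assoc : ∀ p q r (x : Y p) (y : Y q) (z : Y r),
    (⟨_, mul _ _ (mul _ _ x y) z⟩ : Σ p, Y p) = ⟨_, mul _ _ x (mul _ _ y z)⟩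
  unit : A →ₗ[ℂ] Y 0
  isIdentity : (Y 0).IsIdentity unit
  unit_mul : ∀ p a (x : Y p), (⟨_, mul _ _ (unit a) x⟩ : Σ p, Y p) = ⟨_, (Y p).φ a x⟩
  mul_unit : ∀ p (x : Y p) a, (⟨_, mul _ _ x (unit a)⟩ : Σ p, Y p) = ⟨_, (Y p).rsmul x a⟩
  isTensorIso : ∀ p q, p ≠ 0 → q ≠ 0 → Corr.IsTensorIso (mul p q)

/-- A representation `(t, π)` of a correspondence `E` over `A` in a `C*`-algebra `B`. -/
structure Corr.IsRep {A B : Type u} [NonUnitalCStarAlgebra A] [NonUnitalCStarAlgebra B]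
    (E : Corr A A) (t : E →ₗ[ℂ] B) (π : A →⋆ₙₐ[ℂ] B) : Prop where
  map_φ : ∀ a x, t (E.φ a x) = π a * t x
  map_rsmul : ∀ x a, t (E.rsmul x a) = t x * π a
  map_inner : ∀ x y, π (E.inner x y) = star (t x) * t y

/-- A representation of a product system in a `C*`-algebra `B`: maps `ψ p : Y p → B`, where
`ψe : A → B` is `ψ 0` under the identification of `Y 0` with `A`. -/
structure ProductSystem.Rep {P : Type} [AddMonoid P] {A : Type u} [NonUnitalCStarAlgebra A]
    (Y : ProductSystem P A) (B : Type u) [NonUnitalCStarAlgebra B] where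
  ψ : ∀ p, Y.Y p →ₗ[ℂ] B
  ψe : A →⋆ₙₐ[ℂ] B
  ψ_unit : ∀ a, ψ 0 (Y.unit a) = ψe a
  isRep : ∀ p, (Y.Y p).IsRep (ψ p) ψe
  map_mul : ∀ p q (x : Y.Y p) (y : Y.Y q), ψ (p + q) (Y.mul p q x y) = ψ p x * ψ q y

/-- `i : Y → T` is a universal (Toeplitz) representation, that is, `T` is the Toeplitz algebra
`𝒯_Y` with its canonical representation: `T` is generated by the image of `i`, and every
representation of `Y` factors through `i`. -/
structure ProductSystem.Rep.IsToeplitz {P : Type} [AddMonoid P] {A : Type u}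
    [NonUnitalCStarAlgebra A] {Y : ProductSystem P A} {T : Type u} [NonUnitalCStarAlgebra T]
    (i : Y.Rep T) : Prop where
  generates : Dense (NonUnitalStarAlgebra.adjoin ℂ {t : T | ∃ p y, t = i.ψ p y} : Set T)
  lift : ∀ (C : Type u) [NonUnitalCStarAlgebra C] (ψ : Y.Rep C),
    ∃ Φ : T →⋆ₙₐ[ℂ] C, ∀ p y, Φ (i.ψ p y) = ψ.ψ p y

/-- A `k`-graph structure on a small category `Λ`.  A morphism `f : u ⟶ v` is a path with source
`u` and range `v`; the composite of paths `αβ`, with `s(α) = r(β)`, is `β ≫ α`. -/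
structure KGraph (k : ℕ) (Λ : Type u) [SmallCategory Λ] where
  nonempty : Nonempty Λ
  countable : Countable (Σ u v : Λ, (u ⟶ v))
  /-- the degree functor -/
  d : ∀ {u v : Λ}, (u ⟶ v) → (Fin k → ℕ)
  d_id : ∀ v : Λ, d (𝟙 v) = 0
  d_comp : ∀ {u v w : Λ} (α : v ⟶ w) (β : u ⟶ v), d (β ≫ α) = d α + d β
  /-- the factorisation property -/
  factorisation : ∀ {u w : Λ} (f : u ⟶ w) (m n : Fin k → ℕ), d f = m + n →
    ∃! p : Σ v : Λ, (v ⟶ w) × (u ⟶ v),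
      d p.2.1 = m ∧ d p.2.2 = n ∧ p.2.2 ≫ p.2.1 = f

/-- The morphisms of `Λ`. -/
structure KPath (Λ : Type u) [SmallCategory Λ] where
  {src rng : Λ}
  hom : src ⟶ rng

namespace KGraph

variable {k : ℕ} {Λ : Type u} [SmallCategory Λ] (G : KGraph k Λ)

/-- The set `Λⁿ` of paths of degree `n`. -/
def PathOf (n : Fin k → ℕ) : Type u := {p : KPath Λ // G.d p.hom = n}

variable {G} in
/-- A path of degree `n` as an element of `Λⁿ`. -/
abbrev PathOf.mk {n : Fin k → ℕ} {u v : Λ} (f : u ⟶ v) (h : G.d f = n) : G.PathOf n := ⟨⟨f⟩, h⟩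

/-- `vΛⁿ` is finite and nonempty for all vertices `v` and all `n`. -/
def IsRowFiniteNoSources : Prop :=
  ∀ (v : Λ) (n : Fin k → ℕ), {p : KPath Λ | p.rng = v ∧ G.d p.hom = n}.Finite ∧
    {p : KPath Λ | p.rng = v ∧ G.d p.hom = n}.Nonempty

lemma eq_id {u v : Λ} (f : u ⟶ v) (h : G.d f = 0) : ∃ e : u = v, f = eqToHom e := by
  have h1 := (G.factorisation f 0 0 (by rw [h, add_zero])).unique
    (y₁ := ⟨v, 𝟙 v, f⟩) (y₂ := ⟨u, f, 𝟙 u⟩) ⟨G.d_id v, h, by simp⟩ ⟨h, G.d_id u, by simp⟩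
  obtain rfl : v = u := congrArg Sigma.fst h1
  refine ⟨rfl, ?_⟩
  simp only [Sigma.mk.injEq, heq_eq_eq, true_and, Prod.mk.injEq] at h1
  exact h1.2

end KGraph

/-- A `Λ`-system of `C*`-correspondences `(A, X, χ)`.

For a path `f` with source `v` and range `w`, `X f` is an `A_w`-`A_v` correspondence.  The
correspondence `X (𝟙 v)` is identified with the identity correspondence over `A_v` through
`unit v`.  The map `χ_{α,β} : X_α ⊗ X_β → X_{αβ}` is given by its values `χ α β x y` on elementary
tensors `x ⊗ y`.  (For `α` a vertex, `χ_left` determines `χ_{α,β}`, and the map so determined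
always preserves inner products.) -/
structure LambdaSystem {k : ℕ} {Λ : Type u} [SmallCategory Λ] (G : KGraph k Λ) where
  A : Λ → Type u
  [cstarAlgebra : ∀ v, NonUnitalCStarAlgebra (A v)]
  X : ∀ {v w : Λ}, (v ⟶ w) → Corr (A w) (A v)
  χ : ∀ {u v w : Λ} (α : v ⟶ w) (β : u ⟶ v), X α →ₗ[ℂ] X β →ₗ[ℂ] X (β ≫ α)
  χ_map : ∀ {u v w : Λ} (α : v ⟶ w) (β : u ⟶ v), Corr.IsTensorMap (χ α β)
  χ_iso : ∀ {u v w : Λ} (α : v ⟶ w) (β : u ⟶ v), G.d α ≠ 0 → Corr.IsTensorIso (χ α β)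
  unit : ∀ v, A v →ₗ[ℂ] X (𝟙 v)
  isIdentity : ∀ v, (X (𝟙 v)).IsIdentity (unit v)
  χ_left : ∀ {v w : Λ} (f : v ⟶ w) (a : A w) (x : X f),
    (⟨_, χ (𝟙 w) f (unit w a) x⟩ : Σ g : v ⟶ w, X g) = ⟨f, (X f).φ a x⟩
  χ_right : ∀ {v w : Λ} (f : v ⟶ w) (x : X f) (a : A v),
    (⟨_, χ f (𝟙 v) x (unit v a)⟩ : Σ g : v ⟶ w, X g) = ⟨f, (X f).rsmul x a⟩
  χ_assoc : ∀ {t u v w : Λ} (α : v ⟶ w) (β : u ⟶ v) (γ : t ⟶ u) (x : X α) (y : X β) (z : X γ),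
    (⟨_, χ _ _ (χ _ _ x y) z⟩ : Σ g : t ⟶ w, X g) = ⟨_, χ _ _ x (χ _ _ y z)⟩

attribute [instance] LambdaSystem.cstarAlgebra

namespace LambdaSystem

variable {k : ℕ} {Λ : Type u} [SmallCategory Λ] {G : KGraph k Λ} (X : LambdaSystem G)

/-- Regularity of a `Λ`-system. -/
structure IsRegular : Prop where
  rowFinite_noSources : G.IsRowFiniteNoSources
  nondegenerate : ∀ {v w : Λ} (f : v ⟶ w), (X.X f).IsNondegenerate
  full : ∀ {v w : Λ} (f : v ⟶ w), (X.X f).IsFull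
  injective : ∀ {v w : Λ} (f : v ⟶ w), Function.Injective (X.X f).φ
  compact : ∀ {v w : Λ} (f : v ⟶ w) (a : X.A w), (X.X f).IsCompactOp ((X.X f).φ a)

/-- A representation `(ρ, π)` of a `Λ`-system in a `C*`-algebra `B`. -/
structure Rep (B : Type u) [NonUnitalCStarAlgebra B] where
  ρ : ∀ {v w : Λ} (f : v ⟶ w), X.X f →ₗ[ℂ] B
  π : ∀ v, X.A v →⋆ₙₐ[ℂ] B
  ρ_vertex : ∀ v a, ρ (𝟙 v) (X.unit v a) = π v a
  ρ_mul : ∀ {u v w : Λ} (α : v ⟶ w) (β : u ⟶ v) (x : X.X α) (y : X.X β),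
    ρ α x * ρ β y = ρ (β ≫ α) (X.χ α β x y)
  ρ_mul_eq_zero : ∀ {u v v' w : Λ} (α : v ⟶ w) (β : u ⟶ v') (x : X.X α) (y : X.X β),
    v ≠ v' → ρ α x * ρ β y = 0
  ρ_star_mul : ∀ {v w : Λ} (α : v ⟶ w) (x y : X.X α),
    star (ρ α x) * ρ α y = π v ((X.X α).inner x y)
  ρ_star_mul_eq_zero : ∀ {v w v' w' : Λ} (α : v ⟶ w) (β : v' ⟶ w') (x : X.X α) (y : X.X β),
    G.d α = G.d β → (⟨α⟩ : KPath Λ) ≠ ⟨β⟩ → star (ρ α x) * ρ β y = 0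

/-- Universality of a representation of a `Λ`-system. -/
def Rep.IsUniversal {X : LambdaSystem G} {B : Type u} [NonUnitalCStarAlgebra B]
    (R : X.Rep B) : Prop :=
  ∀ (C : Type u) [NonUnitalCStarAlgebra C] (R' : X.Rep C),
    ∃! Φ : B →⋆ₙₐ[ℂ] C,
      (∀ {v w : Λ} (f : v ⟶ w) (x : X.X f), Φ (R.ρ f x) = R'.ρ f x) ∧
      (∀ v a, Φ (R.π v a) = R'.π v a)

/-- The `c₀`-direct sum `A = ⨁ᵥ Aᵥ`. -/
abbrev algA : Type u := C0Sum X.A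

/-- `X_λ` regarded as a correspondence over `A`, for `λ ∈ Λⁿ`. -/
abbrev summand (n : Fin k → ℕ) (l : G.PathOf n) : Corr X.algA X.algA := (X.X l.1.hom).inflate

/-- The fibre `Yₙ = ⨁_{λ ∈ Λⁿ} X_λ` (`ℓ²`-direct sum of correspondences over `A`). -/
def fibre (n : Fin k → ℕ) : Corr X.algA X.algA := Corr.l2Sum (X.summand n)

/-- The inclusion of the summand `X_f` in `Yₙ`, for a path `f` of degree `n`. -/
def incl {n : Fin k → ℕ} {v w : Λ} (f : v ⟶ w) (h : G.d f = n) : X.X f →ₗ[ℂ] X.fibre n :=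
  Corr.L2Sum.single (E := X.summand n) (.mk f h)

/-- The inclusion `ι_α : X_α → Y_{d(α)}`. -/
def ι {v w : Λ} (f : v ⟶ w) : X.X f →ₗ[ℂ] X.fibre (G.d f) := X.incl f rfl

/-- The identification of `X_f` with `X_g` for equal paths `f` and `g`. -/
def castHom {v w : Λ} {f g : v ⟶ w} (h : f = g) : X.X f →ₗ[ℂ] X.X g := h ▸ LinearMap.id

lemma castHom_eq_iff {v w : Λ} {f g : v ⟶ w} (h : f = g) (x : X.X f) (y : X.X g) :
    X.castHom h x = y ↔ (⟨f, x⟩ : Σ g : v ⟶ w, X.X g) = ⟨g, y⟩ := by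
  subst h; simp [castHom]

end LambdaSystem

namespace LambdaSystem

variable {k : ℕ} {Λ : Type u} [SmallCategory Λ] {G : KGraph k Λ} (X : LambdaSystem G)

section Mul

variable {m n : Fin k → ℕ}

/-- The component `x_f ∈ X_f` of `x ∈ Yₙ`, for a path `f` of degree `n`. -/
def coord {u v : Λ} (f : u ⟶ v) (h : G.d f = n) : X.fibre n →ₗ[ℂ] X.X f where
  toFun x := (show Corr.L2Sum (X.summand n) from x) (.mk f h)
  map_add' _ _ := rfl
  map_smul' _ _ := rfl

lemma fibre_ext {x y : X.fibre n}
    (h : ∀ {u v : Λ} (f : u ⟶ v) (hf : G.d f = n), X.coord f hf x = X.coord f hf y) : x = y :=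
  Corr.L2Sum.ext fun l => h l.1.hom l.2

/-- The component `(xy)_{αβ} = χ_{α,β}(x_α ⊗ y_β)`, for `x ∈ Y_m` and `y ∈ Y_n`: every path of
degree `m + n` has a unique factorisation `αβ` with `d(α) = m` and `d(β) = n`. -/
def mulFam (l : G.PathOf (m + n)) : X.fibre m →ₗ[ℂ] X.fibre n →ₗ[ℂ] X.X l.1.hom :=
  let H := (G.factorisation l.1.hom m n l.2).exists
  ((X.χ H.choose.2.1 H.choose.2.2).compl₁₂ (X.coord _ H.choose_spec.1)
    (X.coord _ H.choose_spec.2.1)).compr₂ (X.castHom H.choose_spec.2.2)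

lemma mulFam_apply (x : X.fibre m) (y : X.fibre n) {u v w : Λ} (α : v ⟶ w) (β : u ⟶ v)
    (hα : G.d α = m) (hβ : G.d β = n) {f : u ⟶ w} (h : β ≫ α = f) (hf : G.d f = m + n) :
    X.mulFam (.mk f hf) x y = X.castHom h (X.χ α β (X.coord α hα x) (X.coord β hβ y)) := by
  have key : ∀ p : Σ v : Λ, (v ⟶ w) × (u ⟶ v), p = ⟨v, α, β⟩ →
      ∀ (h1 : G.d p.2.1 = m) (h2 : G.d p.2.2 = n) (h3 : p.2.2 ≫ p.2.1 = f),
      X.castHom h3 (X.χ p.2.1 p.2.2 (X.coord p.2.1 h1 x) (X.coord p.2.2 h2 y)) =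
        X.castHom h (X.χ α β (X.coord α hα x) (X.coord β hβ y)) := by
    rintro p rfl h1 h2 h3
    rfl
  let H := (G.factorisation f m n hf).exists
  exact key H.choose ((G.factorisation f m n hf).unique H.choose_spec ⟨hα, hβ, h⟩) _ _ _

/-- The unique factorisation of a path of degree `m + n`. -/
lemma exists_factor (l : G.PathOf (m + n)) : ∃ (u v w : Λ) (α : v ⟶ w) (β : u ⟶ v)
    (hα : G.d α = m) (hβ : G.d β = n),
    l = .mk (β ≫ α) (by rw [G.d_comp, hα, hβ]) := by
  obtain ⟨⟨f⟩, hl⟩ := l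
  obtain ⟨⟨v, α, β⟩, h1, h2, h3⟩ := (G.factorisation f m n hl).exists
  dsimp only at h1 h2 h3
  subst h3
  exact ⟨_, v, _, α, β, h1, h2, rfl⟩

/-- The factors `(α, β)` of a path `αβ` of degree `m + n`. -/
def split (l : G.PathOf (m + n)) : G.PathOf m × G.PathOf n :=
  let H := (G.factorisation l.1.hom m n l.2).exists
  (.mk _ H.choose_spec.1, .mk _ H.choose_spec.2.1)

lemma split_mk {u v w : Λ} (α : v ⟶ w) (β : u ⟶ v) (hα : G.d α = m) (hβ : G.d β = n)
    (hf : G.d (β ≫ α) = m + n) :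
    split (.mk (β ≫ α) hf) = (.mk α hα, .mk β hβ) := by
  have key : ∀ p : Σ v : Λ, (v ⟶ w) × (u ⟶ v), p = ⟨v, α, β⟩ →
      ∀ (h1 : G.d p.2.1 = m) (h2 : G.d p.2.2 = n),
      ((.mk p.2.1 h1, .mk p.2.2 h2) : G.PathOf m × G.PathOf n) = (.mk α hα, .mk β hβ) := by
    rintro p rfl h1 h2
    rfl
  let H := (G.factorisation (β ≫ α) m n hf).exists
  exact key H.choose ((G.factorisation (β ≫ α) m n hf).unique H.choose_spec ⟨hα, hβ, rfl⟩) _ _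

lemma split_injective : Function.Injective (split (G := G) (m := m) (n := n)) := by
  intro l l' h
  obtain ⟨u, v, w, α, β, hα, hβ, rfl⟩ := exists_factor l
  obtain ⟨u', v', w', α', β', hα', hβ', rfl⟩ := exists_factor l'
  rw [split_mk α β hα hβ, split_mk α' β' hα' hβ', Prod.mk.injEq] at h
  have h1 := congrArg Subtype.val h.1
  have h2 := congrArg Subtype.val h.2
  simp only [KPath.mk.injEq] at h1 h2
  obtain ⟨rfl, rfl, h1⟩ := h1
  obtain ⟨rfl, -, h2⟩ := h2
  obtain rfl := eq_of_heq h1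
  obtain rfl := eq_of_heq h2
  rfl

lemma hasSum_mulFam (x : X.fibre m) (y : X.fibre n) :
    HasSum (fun l => (X.summand (m + n) l).inner (X.mulFam l x y) (X.mulFam l x y))
      ((X.fibre n).inner y ((X.fibre n).φ ((X.fibre m).inner x x) y)) := by
  have h := Corr.hasSum_tensor (E := X.summand m) (F := X.summand n) x y
  rw [← split_injective.hasSum_iff] at h
  · change HasSum _ (Corr.L2Sum.inner y (Corr.L2Sum.φ (Corr.L2Sum.inner x x) y))
    convert h using 1
    funext l
    obtain ⟨u, v, w, α, β, hα, hβ, rfl⟩ := exists_factor l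
    rw [X.mulFam_apply x y α β hα hβ rfl, Function.comp_apply, split_mk α β hα hβ]
    change C0Sum.single u ((X.X (β ≫ α)).inner (X.χ α β _ _) (X.χ α β _ _)) =
      C0Sum.single u ((X.X β).inner _ ((X.X β).φ (C0Sum.eval v (C0Sum.single v _)) _))
    rw [C0Sum.eval_single_same, (X.χ_map α β).inner_map]
    rfl
  · rintro ⟨⟨⟨α⟩, hα⟩, ⟨⟨β⟩, hβ⟩⟩ hr
    rename_i v w u v'
    have hne : v' ≠ v := by
      rintro rfl
      exact hr ⟨.mk (β ≫ α) (by rw [G.d_comp, hα, hβ]), split_mk α β hα hβ _⟩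
    change C0Sum.single u ((X.X β).inner _ ((X.X β).φ (C0Sum.eval v' (C0Sum.single v _)) _)) = 0
    rw [C0Sum.eval_single_ne hne, map_zero]
    exact (congrArg _ (map_zero _)).trans (map_zero _)

/-- The multiplication `Y_m × Y_n → Y_{m+n}`. -/
def mul (m n : Fin k → ℕ) : X.fibre m →ₗ[ℂ] X.fibre n →ₗ[ℂ] X.fibre (m + n) :=
  LinearMap.mk₂ ℂ (fun x y => (show Corr.L2Sum (X.summand (m + n)) from
      ⟨fun l => X.mulFam l x y, (X.hasSum_mulFam x y).summable⟩))
    (fun x x' y => Corr.L2Sum.ext fun l => LinearMap.map_add₂ (X.mulFam l) x x' y)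
    (fun c x y => Corr.L2Sum.ext fun l => LinearMap.map_smul₂ (X.mulFam l) c x y)
    (fun x y y' => Corr.L2Sum.ext fun l => LinearMap.map_add (X.mulFam l x) y y')
    (fun c x y => Corr.L2Sum.ext fun l => LinearMap.map_smul (X.mulFam l x) c y)

lemma coord_mul (x : X.fibre m) (y : X.fibre n) {u v w : Λ} (α : v ⟶ w) (β : u ⟶ v)
    (hα : G.d α = m) (hβ : G.d β = n) {f : u ⟶ w} (h : β ≫ α = f) (hf : G.d f = m + n) :
    X.coord f hf (X.mul m n x y) = X.castHom h (X.χ α β (X.coord α hα x) (X.coord β hβ y)) :=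
  X.mulFam_apply x y α β hα hβ h hf

lemma inner_mul (x x' : X.fibre m) (y y' : X.fibre n) :
    (X.fibre (m + n)).inner (X.mul m n x y) (X.mul m n x' y') =
      (X.fibre n).inner y ((X.fibre n).φ ((X.fibre m).inner x x') y') := by
  have hdiag : ∀ (x : X.fibre m) (y : X.fibre n),
      (X.fibre (m + n)).inner (X.mul m n x y) (X.mul m n x y) =
      (X.fibre n).inner y ((X.fibre n).φ ((X.fibre m).inner x x) y) := by
    intro x y
    exact HasSum.unique (Corr.L2Sum.hasSum_inner _ _) (X.hasSum_mulFam x y)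
  have h1 : ∀ (x : X.fibre m) (y y' : X.fibre n),
      (X.fibre (m + n)).inner (X.mul m n x y) (X.mul m n x y') =
      (X.fibre n).inner y ((X.fibre n).φ ((X.fibre m).inner x x) y') := by
    intro x y y'
    rw [← sub_eq_zero]
    refine Corr.polarisation (fun y : X.fibre n =>
      (X.fibre (m + n)).inner (X.mul m n x y) ∘ₗ X.mul m n x -
      (X.fibre n).inner y ∘ₗ (X.fibre n).φ ((X.fibre m).inner x x)) ?_ ?_ ?_ y y'
    · intro a b c
      simp only [LinearMap.sub_apply, LinearMap.comp_apply, map_add,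
        (X.fibre _).isSemiInner.add_left]
      abel
    · intro c a b
      simp only [LinearMap.sub_apply, LinearMap.comp_apply, map_smul,
        (X.fibre _).isSemiInner.smul_left, smul_sub]
    · intro a
      simp only [LinearMap.sub_apply, LinearMap.comp_apply, hdiag, sub_self]
  rw [← sub_eq_zero]
  refine Corr.polarisation (fun x : X.fibre m =>
    (X.fibre (m + n)).inner (X.mul m n x y) ∘ₗ (X.mul m n).flip y' -
    (X.fibre n).inner y ∘ₗ (X.fibre n).φ.flip y' ∘ₗ (X.fibre m).inner x) ?_ ?_ ?_ x x'
  · intro a b c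
    simp only [LinearMap.sub_apply, LinearMap.comp_apply, map_add, LinearMap.flip_apply,
      LinearMap.add_apply, (X.fibre _).isSemiInner.add_left]
    abel
  · intro c a b
    simp only [LinearMap.sub_apply, LinearMap.comp_apply, map_smul, LinearMap.flip_apply,
      LinearMap.smul_apply, (X.fibre _).isSemiInner.smul_left, smul_sub]
  · intro a
    simp only [LinearMap.sub_apply, LinearMap.comp_apply, LinearMap.flip_apply, h1, sub_self]

lemma sigma_ext {p q : Fin k → ℕ} (h : p = q) (x : X.fibre p) (y : X.fibre q)
    (hxy : ∀ {u v : Λ} (f : u ⟶ v) (hp : G.d f = p) (hq : G.d f = q),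
      X.coord f hp x = X.coord f hq y) :
    (⟨p, x⟩ : Σ p, X.fibre p) = ⟨q, y⟩ := by
  subst h
  congr 1
  exact X.fibre_ext fun f hf => hxy f hf hf

lemma castHom_trans_eq {v w : Λ} {f g h : v ⟶ w} (hf : f = h) (hg : g = h) (x : X.X f) (y : X.X g)
    (e : (⟨f, x⟩ : Σ g : v ⟶ w, X.X g) = ⟨g, y⟩) : X.castHom hf x = X.castHom hg y := by
  subst hf
  exact (X.castHom_eq_iff hg y x).mpr e.symm |>.symm

lemma mul_assoc (l m n : Fin k → ℕ) (x : X.fibre l) (y : X.fibre m) (z : X.fibre n) :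
    (⟨_, X.mul _ _ (X.mul _ _ x y) z⟩ : Σ p, X.fibre p) = ⟨_, X.mul _ _ x (X.mul _ _ y z)⟩ := by
  refine X.sigma_ext (add_assoc l m n) _ _ fun f hp hq => ?_
  obtain ⟨⟨v, δ, γ⟩, hδ, hγ, rfl⟩ := (G.factorisation f (l + m) n hp).exists
  dsimp only at hδ hγ hp hq ⊢
  obtain ⟨⟨v', α, β⟩, hα, hβ, rfl⟩ := (G.factorisation δ l m hδ).exists
  dsimp only at hα hβ hδ hp hq ⊢
  rw [X.coord_mul _ z (β ≫ α) γ hδ hγ rfl, X.coord_mul x y α β hα hβ rfl,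
    X.coord_mul x _ α (γ ≫ β) hα (by rw [G.d_comp, hβ, hγ]) (Category.assoc _ _ _),
    X.coord_mul y z β γ hβ hγ rfl]
  exact X.castHom_trans_eq _ _ _ _ (X.χ_assoc α β γ _ _ _)

end Mul

section Unit

/-- `X_f` is the identity correspondence if `f` is an identity morphism. -/
def idMap {u v : Λ} (f : u ⟶ v) (e : u = v) (h : f = eqToHom e) : X.A u →ₗ[ℂ] X.X f := by
  subst e
  exact X.castHom (f := 𝟙 u) h.symm ∘ₗ X.unit u

lemma idMap_id (v : Λ) (e : v = v) (h : 𝟙 v = eqToHom e) : X.idMap (𝟙 v) e h = X.unit v := rfl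

lemma hasSum_C0Sum {V : Type u} {A : V → Type u} [∀ v, NonUnitalCStarAlgebra (A v)]
    (a : C0Sum A) : HasSum (fun v => C0Sum.single v (C0Sum.eval v a)) a := by
  classical
  refine Metric.tendsto_atTop.mpr fun ε hε => ?_
  have ha : ∀ᶠ v in cofinite, ‖C0Sum.eval v a‖ < ε / 2 := by
    have : Tendsto (fun v => ‖C0Sum.eval v a‖) cofinite (𝓝 0) := a.2
    exact this.eventually (gt_mem_nhds (by positivity))
  rw [eventually_cofinite] at ha
  refine ⟨ha.toFinset, fun F hF => lt_of_le_of_lt ?_ (half_lt_self hε)⟩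
  rw [dist_comm, dist_eq_norm]
  refine lp.norm_le_of_forall_le (E := A) (by positivity) fun w => ?_
  change ‖C0Sum.eval w (a - ∑ v ∈ F, C0Sum.single v (C0Sum.eval v a))‖ ≤ ε / 2
  rw [map_sub, map_sum]
  by_cases hw : w ∈ F
  · rw [Finset.sum_eq_single w (fun v _ hv => C0Sum.eval_single_ne hv.symm _)
      (fun h => absurd hw h), C0Sum.eval_single_same, sub_self, norm_zero]
    positivity
  · rw [Finset.sum_eq_zero (fun v hv => C0Sum.eval_single_ne (by rintro rfl; exact hw hv) _),
      sub_zero]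
    by_contra hlt
    exact hw (hF (by simpa using (not_le.mp hlt).le))

/-- Vertices are the paths of degree `0`. -/
def vertexEquiv (G : KGraph k Λ) : Λ ≃ G.PathOf 0 where
  toFun v := .mk (𝟙 v) (G.d_id v)
  invFun l := l.1.src
  left_inv _ := rfl
  right_inv l := by
    obtain ⟨⟨f⟩, h⟩ := l
    obtain ⟨rfl, rfl⟩ := G.eq_id f h
    rfl

/-- The element of `Y₀ = ⨁ᵥ Xᵥ` corresponding to `a ∈ A = ⨁ᵥ Aᵥ`. -/
def unitFam (l : G.PathOf 0) : X.algA →ₗ[ℂ] X.X l.1.hom :=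
  X.idMap l.1.hom (G.eq_id l.1.hom l.2).choose (G.eq_id l.1.hom l.2).choose_spec ∘ₗ
    C0Sum.evalₗ l.1.src

lemma unitFam_id (v : Λ) (h : G.d (𝟙 v) = 0) (a : X.algA) :
    X.unitFam (.mk (𝟙 v) h) a = X.unit v (C0Sum.eval v a) := rfl

lemma hasSum_unitFam (a b : X.algA) :
    HasSum (fun l => (X.summand 0 l).inner (X.unitFam l a) (X.unitFam l b)) (star a * b) := by
  rw [← (vertexEquiv G).hasSum_iff]
  convert hasSum_C0Sum (star a * b) using 1
  funext v
  change C0Sum.single v ((X.X (𝟙 v)).inner (X.unit v (C0Sum.eval v a))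
    (X.unit v (C0Sum.eval v b))) = _
  rw [(X.isIdentity v).inner_map, map_mul (C0Sum.eval v), map_star (C0Sum.eval v)]

/-- The identification of `A = ⨁ᵥ Aᵥ` with `Y₀ = ⨁ᵥ Xᵥ`. -/
def unitMap : X.algA →ₗ[ℂ] X.fibre 0 where
  toFun a := show Corr.L2Sum (X.summand 0) from
    ⟨fun l => X.unitFam l a, (X.hasSum_unitFam a a).summable⟩
  map_add' a b := Corr.L2Sum.ext fun l => map_add (X.unitFam l) a b
  map_smul' c a := Corr.L2Sum.ext fun l => map_smul (X.unitFam l) c a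

lemma coord_unitMap (v : Λ) (h : G.d (𝟙 v) = 0) (a : X.algA) :
    X.coord (𝟙 v) h (X.unitMap a) = X.unit v (C0Sum.eval v a) := rfl

lemma fibre_zero_ext {x y : X.fibre 0}
    (h : ∀ v, X.coord (𝟙 v) (G.d_id v) x = X.coord (𝟙 v) (G.d_id v) y) : x = y := by
  refine X.fibre_ext fun f hf => ?_
  obtain ⟨rfl, rfl⟩ := G.eq_id f hf
  exact h _

lemma norm_unit (v : Λ) (a : X.A v) : ‖X.unit v a‖ = ‖a‖ := by
  rw [(X.X (𝟙 v)).norm_eq, (X.isIdentity v).inner_map, CStarRing.norm_star_mul_self,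
    Real.sqrt_mul_self (norm_nonneg _)]

lemma isIdentity_unitMap : (X.fibre 0).IsIdentity X.unitMap where
  surjective y := by
    choose a ha using fun v => (X.isIdentity v).surjective (X.coord (𝟙 v) (G.d_id v) y)
    let y' : Corr.L2Sum (X.summand 0) := y
    have hn : ∀ v, ‖a v‖ = ‖y' (vertexEquiv G v)‖ := fun v => by
      rw [← X.norm_unit, ha]; rfl
    have hmem : Memℓp a ∞ := by
      refine memℓp_infty ⟨‖y'‖, ?_⟩
      rintro _ ⟨v, rfl⟩
      exact (hn v).trans_le (Corr.L2Sum.norm_apply_le y' _)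
    have hc0 : Tendsto (fun v => ‖a v‖) cofinite (𝓝 0) := by
      have h1 : Tendsto (fun l => ‖(X.summand 0 l).inner (y' l) (y' l)‖) cofinite (𝓝 0) := by
        simpa using (Corr.L2Sum.summable_inner y' y').tendsto_cofinite_zero.norm
      have h2 := (h1.comp (vertexEquiv G).injective.tendsto_cofinite).sqrt
      rw [Real.sqrt_zero] at h2
      refine h2.congr fun v => ?_
      rw [hn]
      exact ((X.summand 0 _).norm_eq _).symm
    let b : C0Sum X.A := show c0Sub X.A from ⟨⟨a, hmem⟩, hc0⟩
    exact ⟨b, X.fibre_zero_ext fun v => (X.coord_unitMap v (G.d_id v) b).trans (ha v)⟩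
  inner_map a b := HasSum.unique (Corr.L2Sum.hasSum_inner _ _) (X.hasSum_unitFam a b)
  φ_map a b := X.fibre_zero_ext fun v => by
    rw [X.coord_unitMap, map_mul, ← (X.isIdentity v).φ_map]
    rfl
  rsmul_map a b := X.fibre_zero_ext fun v => by
    rw [X.coord_unitMap, map_mul, ← (X.isIdentity v).rsmul_map]
    rfl

lemma unit_mul (n : Fin k → ℕ) (a : X.algA) (x : X.fibre n) :
    (⟨_, X.mul _ _ (X.unitMap a) x⟩ : Σ p, X.fibre p) = ⟨_, (X.fibre n).φ a x⟩ := by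
  refine X.sigma_ext (zero_add n) _ _ fun f hp hq => ?_
  rw [X.coord_mul _ x (𝟙 _) f (G.d_id _) hq (Category.comp_id f), X.coord_unitMap,
    X.castHom_eq_iff, X.χ_left]
  rfl

lemma mul_unit (n : Fin k → ℕ) (x : X.fibre n) (a : X.algA) :
    (⟨_, X.mul _ _ x (X.unitMap a)⟩ : Σ p, X.fibre p) = ⟨_, (X.fibre n).rsmul x a⟩ := by
  refine X.sigma_ext (add_zero n) _ _ fun f hp hq => ?_
  rw [X.coord_mul x _ f (𝟙 _) hq (G.d_id _) (Category.id_comp f), X.coord_unitMap,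
    X.castHom_eq_iff, X.χ_right]
  rfl

end Unit

section System

lemma coord_incl_same {n : Fin k → ℕ} {v w : Λ} (f : v ⟶ w) (h : G.d f = n) (x : X.X f) :
    X.coord f h (X.incl f h x) = x :=
  Corr.L2Sum.single_same (E := X.summand n) (.mk f h) x

lemma coord_incl_ne {n : Fin k → ℕ} {v w v' w' : Λ} (f : v ⟶ w) (h : G.d f = n)
    (g : v' ⟶ w') (h' : G.d g = n) (hne : (KGraph.PathOf.mk g h' : G.PathOf n) ≠ .mk f h)
    (x : X.X f) : X.coord g h' (X.incl f h x) = 0 :=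
  Corr.L2Sum.single_ne (E := X.summand n) hne x

lemma continuous_incl {n : Fin k → ℕ} {v w : Λ} (f : v ⟶ w) (h : G.d f = n) :
    Continuous (X.incl f h) :=
  (AddMonoidHomClass.isometry_of_norm (X.incl f h) fun x =>
    Corr.L2Sum.norm_single (E := X.summand n) (.mk f h) x).continuous

/-- `ι_α(x) ι_β(y) = ι_{αβ}(χ_{α,β}(x ⊗ y))` if `s(α) = r(β)`. -/
lemma incl_mul_incl {m n : Fin k → ℕ} {u v w : Λ} (α : v ⟶ w) (β : u ⟶ v) (hα : G.d α = m)
    (hβ : G.d β = n) (hf : G.d (β ≫ α) = m + n) (x : X.X α) (y : X.X β) :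
    X.mul m n (X.incl α hα x) (X.incl β hβ y) = X.incl (β ≫ α) hf (X.χ α β x y) := by
  refine Corr.L2Sum.ext fun l => ?_
  obtain ⟨u', v', w', α', β', hα', hβ', rfl⟩ := exists_factor l
  have hf' : G.d (β' ≫ α') = m + n := by rw [G.d_comp, hα', hβ']
  refine (X.coord_mul _ _ α' β' hα' hβ' rfl hf').trans ?_
  change X.χ α' β' _ _ = X.coord (β' ≫ α') hf' (X.incl (β ≫ α) hf (X.χ α β x y))
  by_cases h : (KGraph.PathOf.mk (β' ≫ α') hf' : G.PathOf (m + n)) = .mk (β ≫ α) hf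
  · have h' := congrArg split h
    rw [split_mk α β hα hβ, split_mk α' β' hα' hβ', Prod.mk.injEq] at h'
    have h1 := congrArg Subtype.val h'.1
    have h2 := congrArg Subtype.val h'.2
    simp only [KPath.mk.injEq] at h1 h2
    obtain ⟨rfl, rfl, h1⟩ := h1
    obtain ⟨rfl, -, h2⟩ := h2
    obtain rfl := eq_of_heq h1
    obtain rfl := eq_of_heq h2
    rw [coord_incl_same, coord_incl_same, coord_incl_same]
  · rw [X.coord_incl_ne _ _ _ _ h]
    by_cases h1 : (KGraph.PathOf.mk α' hα' : G.PathOf m) = .mk α hα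
    · by_cases h2 : (KGraph.PathOf.mk β' hβ' : G.PathOf n) = .mk β hβ
      · refine absurd (split_injective ?_) h
        rw [split_mk α β hα hβ, split_mk α' β' hα' hβ', h1, h2]
      · rw [X.coord_incl_ne _ _ _ _ h2, map_zero]
    · rw [X.coord_incl_ne _ _ _ _ h1, map_zero, LinearMap.zero_apply]

/-- `ι_α(x) ι_β(y) = 0` if `s(α) ≠ r(β)`. -/
lemma incl_mul_incl_eq_zero {m n : Fin k → ℕ} {u v v' w : Λ} (α : v ⟶ w) (β : u ⟶ v')
    (hα : G.d α = m) (hβ : G.d β = n) (hne : v ≠ v') (x : X.X α) (y : X.X β) :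
    X.mul m n (X.incl α hα x) (X.incl β hβ y) = 0 := by
  refine Corr.L2Sum.ext fun l => ?_
  obtain ⟨u₁, v₁, w₁, α', β', hα', hβ', rfl⟩ := exists_factor l
  refine (X.coord_mul _ _ α' β' hα' hβ' rfl (by rw [G.d_comp, hα', hβ'])).trans ?_
  change X.χ α' β' _ _ = 0
  by_cases h1 : (KGraph.PathOf.mk α' hα' : G.PathOf m) = .mk α hα
  · by_cases h2 : (KGraph.PathOf.mk β' hβ' : G.PathOf n) = .mk β hβ
    · have h1 := congrArg (fun l => l.1.src) h1
      have h2 := congrArg (fun l => l.1.rng) h2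
      exact absurd (h1.symm.trans h2) hne
    · rw [X.coord_incl_ne _ _ _ _ h2, map_zero]
  · rw [X.coord_incl_ne _ _ _ _ h1, map_zero, LinearMap.zero_apply]

lemma isTensorIso_mul (m n : Fin k → ℕ) (hm : m ≠ 0) : Corr.IsTensorIso (X.mul m n) where
  inner_map x y x' y' := X.inner_mul x x' y y'
  map_φ a x y := by
    refine Corr.L2Sum.ext fun l => ?_
    obtain ⟨u, v, w, α, β, hα, hβ, rfl⟩ := exists_factor l
    have h1 := X.coord_mul ((X.fibre m).φ a x) y α β hα hβ rfl (by rw [G.d_comp, hα, hβ])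
    have h2 := X.coord_mul x y α β hα hβ rfl (by rw [G.d_comp, hα, hβ])
    refine h1.trans (Eq.trans ?_ (congrArg ((X.X (β ≫ α)).φ (C0Sum.eval w a)) h2.symm))
    exact (X.χ_map α β).map_φ _ _ _
  map_rsmul x y a := by
    refine Corr.L2Sum.ext fun l => ?_
    obtain ⟨u, v, w, α, β, hα, hβ, rfl⟩ := exists_factor l
    have h1 := X.coord_mul x ((X.fibre n).rsmul y a) α β hα hβ rfl (by rw [G.d_comp, hα, hβ])
    have h2 := X.coord_mul x y α β hα hβ rfl (by rw [G.d_comp, hα, hβ])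
    refine h1.trans (Eq.trans ?_ (congrArg
      (fun z => (X.X (β ≫ α)).rsmul z (C0Sum.eval u a)) h2.symm))
    exact (X.χ_map α β).map_rsmul _ _ _
  dense := by
    refine Corr.L2Sum.dense_of_single _ fun l z => ?_
    obtain ⟨u, v, w, α, β, hα, hβ, rfl⟩ := exists_factor l
    have hd := (X.χ_iso α β (by rwa [hα])).dense z
    have hf : G.d (β ≫ α) = m + n := by rw [G.d_comp, hα, hβ]
    have hmaps : Set.MapsTo (X.incl (β ≫ α) hf)
        (Submodule.span ℂ {z | ∃ x y, z = X.χ α β x y} : Set (X.X (β ≫ α)))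
        (Submodule.span ℂ {z | ∃ x y, z = X.mul m n x y} : Set (X.fibre (m + n))) := ?_
    · exact map_mem_closure (X.continuous_incl (β ≫ α) hf) hd hmaps
    intro z hz
    refine Submodule.span_induction (p := fun z _ =>
      X.incl (β ≫ α) hf z ∈ Submodule.span ℂ {z | ∃ x y, z = X.mul m n x y})
      ?_ ?_ ?_ ?_ hz
    · rintro _ ⟨x, y, rfl⟩
      exact Submodule.subset_span ⟨X.incl α hα x, X.incl β hβ y,
        (X.incl_mul_incl α β hα hβ hf x y).symm⟩
    · rw [map_zero]; exact Submodule.zero_mem _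
    · intro a b _ _ ha hb
      rw [map_add]; exact Submodule.add_mem _ ha hb
    · intro c a _ ha
      rw [map_smul]; exact Submodule.smul_mem _ _ ha

/-- The product system `Y_X` over `ℕᵏ` associated to a `Λ`-system `X`. -/
def productSystem : ProductSystem (Fin k → ℕ) X.algA where
  Y := X.fibre
  mul := X.mul
  mul_assoc := X.mul_assoc
  unit := X.unitMap
  isIdentity := X.isIdentity_unitMap
  unit_mul := X.unit_mul
  mul_unit := X.mul_unit
  isTensorIso m n hm _ := X.isTensorIso_mul m n hm

end System

end LambdaSystem

namespace LambdaSystem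

variable {k : ℕ} {Λ : Type u} [SmallCategory Λ] {G : KGraph k Λ} (X : LambdaSystem G)

/-- The inclusion `ι_v : A_v → A = Y₀`. -/
def ιVertex (v : Λ) : X.A v →ₗ[ℂ] X.fibre 0 := X.unitMap ∘ₗ C0Sum.singleₗ v

/-- `(ρ, π)` is given by `ρ_α = ψ ∘ ι_α` and `π_v = ψ ∘ ι_v`, that is, `(ρ, π) = (ρ^ψ, π^ψ)`. -/
def Rep.IsInducedBy {X : LambdaSystem G} {B : Type u} [NonUnitalCStarAlgebra B] (R : X.Rep B)
    (ψ : X.productSystem.Rep B) : Prop :=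
  (∀ {v w : Λ} (f : v ⟶ w) (x : X.X f), R.ρ f x = ψ.ψ (G.d f) (X.ι f x)) ∧
    ∀ (v : Λ) (a : X.A v), R.π v a = ψ.ψ 0 (X.ιVertex v a)

end LambdaSystem

end

noncomputable section

/-! The fibre `Yₙ` is the closed span of its mutually orthogonal summands `X_λ`, `d(λ) = n`, and the
product of two summands is given by `χ`. The relations defining a representation of `X` are the
relations of a representation of `Y`, written out on the summands; what remains is a matter of
convergence.

A representation of a correspondence is contractive, because `‖t x‖² = ‖π⟨x, x⟩‖ ≤ ‖⟨x, x⟩‖ = ‖x‖²`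
(`Corr.IsRep.norm_le`). Hence a representation of `Y` is determined by its values on the summands
(`ψ_ext`), and restricting it to them gives a representation of `X` (`inducedRep`).

Conversely, let `(ρ, π)` be a representation of `X`. The images of the `π_v` are mutually
orthogonal, so finite sums of the `π_v` are `*`-homomorphisms, hence contractive, and `a ↦ ∑
π_v(a_v)` converges on the `c₀`-sum to a `*`-homomorphism `sumπ`. Relation (3) removes the cross
terms from `(∑ ρ_λ(x_λ))* (∑ ρ_λ(x_λ))`, so a finite sum satisfies `‖∑ ρ_λ(x_λ)‖² ≤ ‖∑ ⟨x_λ, x_λ⟩‖`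
(`sq_norm_sum_ρ`). The series `∑ ρ_λ(x_λ)` therefore converges on the `ℓ²`-sum. The module and inner
product identities follow by comparing series term by term, and multiplicativity by continuity from
the summands.

For the Toeplitz algebra, every representation of `Y` evaluates formal words in the elements of `Y`
and their adjoints, and so defines a seminorm on the free algebra of words. These seminorms form a
set. Choosing one representation for each and taking the `ℓ^∞`-product, which exists by
contractivity, gives a representation whose word norm dominates all others. On the closed
`*`-algebra generated by its image, every representation factors through it by continuous extension
(`exists_isToeplitz`). Transporting this property along the correspondence of representations gives
universality for `X`. -/

/-! ### Representations of correspondences and product systems: contractivity and extensionality -/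

lemma continuous_starHom {A B : Type u} [NonUnitalCStarAlgebra A] [NonUnitalCStarAlgebra B]
    (π : A →⋆ₙₐ[ℂ] B) : Continuous π :=
  AddMonoidHomClass.continuous_of_bound π 1 fun a => by
    simpa using NonUnitalStarAlgHom.norm_apply_le π a

/-- The `C*`-identity turns `‖t x‖²` into `‖π⟨x, x⟩‖`, and a `*`-homomorphism is contractive. Every
continuity argument for representations below rests on this, as does the existence of products of
representations. -/
lemma Corr.IsRep.norm_le {A B : Type u} [NonUnitalCStarAlgebra A] [NonUnitalCStarAlgebra B]
    {E : Corr A A} {t : E →ₗ[ℂ] B} {π : A →⋆ₙₐ[ℂ] B} (h : E.IsRep t π) (x : E) :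
    ‖t x‖ ≤ ‖x‖ := by
  refine le_of_sq_le_sq ?_ (norm_nonneg x)
  rw [E.norm_sq, pow_two, ← CStarRing.norm_star_mul_self, ← h.map_inner]
  exact NonUnitalStarAlgHom.norm_apply_le π _

lemma Corr.IsRep.continuous {A B : Type u} [NonUnitalCStarAlgebra A] [NonUnitalCStarAlgebra B]
    {E : Corr A A} {t : E →ₗ[ℂ] B} {π : A →⋆ₙₐ[ℂ] B} (h : E.IsRep t π) : Continuous t :=
  AddMonoidHomClass.continuous_of_bound t 1 fun x => by simpa using h.norm_le x

/-- The component `ψe` carries no further data, since `ψ_unit` recovers it from `ψ 0`. -/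
lemma ProductSystem.Rep.ext_of_ψ {P : Type} [AddMonoid P] {A : Type u} [NonUnitalCStarAlgebra A]
    {Y : ProductSystem P A} {B : Type u} [NonUnitalCStarAlgebra B] {φ ψ : Y.Rep B}
    (h : ∀ p y, φ.ψ p y = ψ.ψ p y) : φ = ψ := by
  obtain ⟨f, f₀, hf, _, _⟩ := φ
  obtain ⟨g, g₀, hg, _, _⟩ := ψ
  obtain rfl : f = g := funext fun p => LinearMap.ext (h p)
  obtain rfl : f₀ = g₀ := NonUnitalStarAlgHom.ext fun a => (hf a).symm.trans (hg a)
  rfl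

lemma Corr.L2Sum.inner_single {A B I : Type u} [NonUnitalCStarAlgebra A]
    [NonUnitalCStarAlgebra B] {E : I → Corr A B} (i : I) (x : E i) (y : L2Sum E) :
    inner (single i x) y = (E i).inner x (y i) := by
  refine HasSum.unique (hasSum_inner _ _) ?_
  have := hasSum_single (f := fun j => (E j).inner (single i x j) (y j)) i fun j hj => by
    -- The inner product is bundled as linear in its second variable only, so vanishing in the first
    -- variable comes from conjugate symmetry.
    rw [single_ne hj, ← (E j).star_inner, map_zero, star_zero]
  simpa using this

/-! ### From representations of `Y` to representations of `X` -/

namespace LambdaSystem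

variable {k : ℕ} {Λ : Type u} [SmallCategory Λ] {G : KGraph k Λ} {X : LambdaSystem G}
  {B : Type u} [NonUnitalCStarAlgebra B]

/-- By `ρ_vertex`, `π_v` is the restriction of `ρ` to the identity path at `v`. -/
lemma Rep.ext_of_ρ {R S : X.Rep B}
    (h : ∀ {v w : Λ} (f : v ⟶ w) (x : X.X f), R.ρ f x = S.ρ f x) : R = S := by
  have hρ : @Rep.ρ k Λ _ G X B _ R = @Rep.ρ k Λ _ G X B _ S := by
    funext v w f
    exact LinearMap.ext (h f)
  have hπ : R.π = S.π := by
    funext v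
    refine NonUnitalStarAlgHom.ext fun a => ?_
    rw [← R.ρ_vertex, ← S.ρ_vertex, h]
  obtain ⟨_, _, _, _, _, _, _⟩ := R
  obtain ⟨_, _, _, _, _, _, _⟩ := S
  obtain rfl := hρ
  obtain rfl := hπ
  rfl

lemma inner_incl {n : Fin k → ℕ} {v w : Λ} (f : v ⟶ w) (h : G.d f = n) (x : X.X f)
    (y : X.fibre n) :
    (X.fibre n).inner (X.incl f h x) y = C0Sum.single v ((X.X f).inner x (X.coord f h y)) :=
  Corr.L2Sum.inner_single (E := X.summand n) (.mk f h) x y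

/-- The two ways of putting `A_v` into `Y₀` agree: through the `c₀`-sum `A`, and as the summand of
the path `𝟙 v`. This is what makes `ρ^ψ` and `π^ψ` compatible at vertices. -/
lemma unitMap_single (v : Λ) (a : X.A v) :
    X.unitMap (C0Sum.single v a) = X.incl (𝟙 v) (G.d_id v) (X.unit v a) := by
  refine X.fibre_zero_ext fun w => ?_
  rw [coord_unitMap]
  by_cases h : w = v
  · subst h
    rw [coord_incl_same, C0Sum.eval_single_same]
  · rw [C0Sum.eval_single_ne h, map_zero, coord_incl_ne]
    intro e
    exact h (congrArg (fun l => l.1.src) e)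

lemma hasSum_incl {n : Fin k → ℕ} (x : X.fibre n) :
    HasSum (fun l : G.PathOf n => X.incl l.1.hom l.2 (X.coord l.1.hom l.2 x)) x :=
  Corr.L2Sum.hasSum_single_apply (E := X.summand n) x

/-- Continuous linear maps on a fibre are determined on the summands. -/
lemma fibre_linearMap_ext {n : Fin k → ℕ} {V : Type*} [AddCommMonoid V] [TopologicalSpace V]
    [T2Space V] [Module ℂ V] {S T : X.fibre n →ₗ[ℂ] V} (hS : Continuous S) (hT : Continuous T)
    (h : ∀ {v w : Λ} (f : v ⟶ w) (hf : G.d f = n) (x : X.X f),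
      S (X.incl f hf x) = T (X.incl f hf x)) (x : X.fibre n) : S x = T x := by
  have h1 := (hasSum_incl x).map S hS
  have h2 := (hasSum_incl x).map T hT
  have e : S ∘ (fun l : G.PathOf n => X.incl l.1.hom l.2 (X.coord l.1.hom l.2 x)) =
      T ∘ fun l : G.PathOf n => X.incl l.1.hom l.2 (X.coord l.1.hom l.2 x) :=
    funext fun l => h _ _ _
  exact (e ▸ h1).unique h2

/-- Here `‖xy‖² = ‖⟨y, ⟨x, x⟩ · y⟩‖`, and Cauchy–Schwarz together with `‖⟨x, x⟩‖ = ‖x‖²` bounds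
this. The resulting separate continuity allows product formulas to be checked on summands. -/
lemma norm_mul_le {m n : Fin k → ℕ} (x : X.fibre m) (y : X.fibre n) :
    ‖X.mul m n x y‖ ≤ ‖x‖ * ‖y‖ := by
  refine le_of_sq_le_sq ?_ (by positivity)
  rw [(X.fibre (m + n)).norm_sq, inner_mul]
  refine ((X.fibre n).isSemiInner.norm_le _ _).trans ?_
  rw [← (X.fibre n).norm_eq, ← (X.fibre n).norm_eq]
  refine (mul_le_mul_of_nonneg_left ((X.fibre n).norm_φ_le _ _) (norm_nonneg _)).trans ?_
  rw [← (X.fibre m).norm_sq]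
  exact le_of_eq (by ring)

lemma continuous_mul_right {m n : Fin k → ℕ} (x : X.fibre m) : Continuous (X.mul m n x) :=
  AddMonoidHomClass.continuous_of_bound _ ‖x‖ fun y => norm_mul_le x y

lemma continuous_mul_left {m n : Fin k → ℕ} (y : X.fibre n) :
    Continuous ((X.mul m n).flip y) :=
  AddMonoidHomClass.continuous_of_bound _ ‖y‖ fun x => (norm_mul_le x y).trans_eq (mul_comm _ _)

/-- Degrees such as `d(αβ)` and `d(α) + d(β)` are equal only by a proof, so they index different
fibres. This moves a summand between such fibres without changing its image in `B`. -/
lemma ψ_incl (ψ : X.productSystem.Rep B) {n : Fin k → ℕ} {v w : Λ} (f : v ⟶ w) (h : G.d f = n)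
    (x : X.X f) : ψ.ψ (G.d f) (X.ι f x) = ψ.ψ n (X.incl f h x) := by
  subst h
  rfl

/-- The representation `(ρ^ψ, π^ψ)` of `X` induced by a representation `ψ` of `Y_X`. -/
def inducedRep (ψ : X.productSystem.Rep B) : X.Rep B where
  ρ f := ψ.ψ (G.d f) ∘ₗ X.ι f
  π v := ψ.ψe.comp (C0Sum.single v)
  ρ_vertex v a := by
    refine (ψ_incl ψ (𝟙 v) (G.d_id v) (X.unit v a)).trans ?_
    rw [← unitMap_single]
    exact ψ.ψ_unit _
  ρ_mul α β x y := by
    refine (ψ.map_mul _ _ _ _).symm.trans ?_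
    refine Eq.trans ?_ (ψ_incl ψ (β ≫ α) (G.d_comp α β) (X.χ α β x y)).symm
    exact congrArg (ψ.ψ _) (X.incl_mul_incl α β rfl rfl (G.d_comp α β) x y)
  ρ_mul_eq_zero α β x y hne := by
    refine (ψ.map_mul _ _ _ _).symm.trans ?_
    exact (congrArg (ψ.ψ _) (X.incl_mul_incl_eq_zero α β rfl rfl hne x y)).trans (map_zero _)
  ρ_star_mul α x y := by
    refine ((ψ.isRep _).map_inner _ _).symm.trans ?_
    refine congrArg ψ.ψe ((inner_incl α rfl x _).trans ?_)
    exact congrArg (fun z => C0Sum.single _ ((X.X α).inner x z)) (X.coord_incl_same α rfl y)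
  ρ_star_mul_eq_zero α β x y hd hne := by
    -- The vector at `β` is moved to the fibre of degree `d(α)`: only there can the inner product be
    -- formed, and there distinct summands are orthogonal.
    have h := ψ_incl ψ β hd.symm y
    refine (congrArg (star (ψ.ψ (G.d α) (X.ι α x)) * ·) h).trans ?_
    refine ((ψ.isRep _).map_inner _ _).symm.trans ?_
    refine (congrArg ψ.ψe ((inner_incl α rfl x _).trans ?_)).trans (map_zero _)
    rw [coord_incl_ne _ _ _ _ _ fun e => hne (congrArg Subtype.val e), map_zero, map_zero]

lemma inducedRep_isInducedBy (ψ : X.productSystem.Rep B) : (inducedRep ψ).IsInducedBy ψ :=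
  ⟨fun _ _ => rfl, fun v a => (ψ.ψ_unit (C0Sum.single v a)).symm⟩

/-- Representations are continuous and each fibre is the closed span of its summands. This gives the
uniqueness of `ψ^{(ρ, π)}` and the identity `ψ^{(ρ^ψ, π^ψ)} = ψ`. -/
lemma ψ_ext {φ ψ : X.productSystem.Rep B}
    (h : ∀ {v w : Λ} (f : v ⟶ w) (x : X.X f), φ.ψ (G.d f) (X.ι f x) = ψ.ψ (G.d f) (X.ι f x)) :
    φ = ψ := by
  refine ProductSystem.Rep.ext_of_ψ fun n y => ?_
  refine fibre_linearMap_ext (X := X) (φ.isRep n).continuous (ψ.isRep n).continuous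
    (fun f hf x => ?_) y
  exact (ψ_incl φ f hf x).symm.trans ((h f x).trans (ψ_incl ψ f hf x))

end LambdaSystem

/-! ### From representations of `X` to representations of `Y` -/

namespace LambdaSystem

variable {k : ℕ} {Λ : Type u} [SmallCategory Λ] {G : KGraph k Λ} {X : LambdaSystem G}
  {B : Type u} [NonUnitalCStarAlgebra B]

namespace Rep

variable (R : X.Rep B)

/-- Relation (2) for two identity paths that are not composable. This orthogonality is what makes
sums of the `π_v` multiplicative. -/
lemma π_mul_π_of_ne {v w : Λ} (h : v ≠ w) (a : X.A v) (b : X.A w) : R.π v a * R.π w b = 0 := by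
  rw [← R.ρ_vertex, ← R.ρ_vertex]
  exact R.ρ_mul_eq_zero _ _ _ _ h

/-- The axioms `χ_left` and `χ_right` are equalities in a sigma type, since composing with an
identity path changes the index of the correspondence. They enter computations in `B` through this
lemma. -/
lemma ρ_congr {v w : Λ} {f g : v ⟶ w} {x : X.X f} {y : X.X g}
    (h : (⟨f, x⟩ : Σ g : v ⟶ w, X.X g) = ⟨g, y⟩) : R.ρ f x = R.ρ g y :=
  congrArg (fun p : Σ g : v ⟶ w, X.X g => R.ρ p.1 p.2) h

/-- Compatibility with the left action is not an axiom of `Rep`: it is relation (2) with an identity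
path as left factor. The right action is treated likewise in `ρ_rsmul`. -/
lemma ρ_φ {v w : Λ} (f : v ⟶ w) (a : X.A w) (x : X.X f) :
    R.ρ f ((X.X f).φ a x) = R.π w a * R.ρ f x := by
  rw [← R.ρ_vertex, R.ρ_mul]
  exact (R.ρ_congr (X.χ_left f a x)).symm

lemma ρ_rsmul {v w : Λ} (f : v ⟶ w) (x : X.X f) (a : X.A v) :
    R.ρ f ((X.X f).rsmul x a) = R.ρ f x * R.π v a := by
  rw [← R.ρ_vertex, R.ρ_mul]
  exact (R.ρ_congr (X.χ_right f x a)).symm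

lemma π_mul_ρ_of_ne {u v w : Λ} (f : v ⟶ w) (h : u ≠ w) (a : X.A u) (x : X.X f) :
    R.π u a * R.ρ f x = 0 := by
  rw [← R.ρ_vertex]
  exact R.ρ_mul_eq_zero _ _ _ _ h

lemma ρ_mul_π_of_ne {u v w : Λ} (f : v ⟶ w) (h : v ≠ u) (x : X.X f) (a : X.A u) :
    R.ρ f x * R.π u a = 0 := by
  rw [← R.ρ_vertex]
  exact R.ρ_mul_eq_zero _ _ _ _ h

/-- The homomorphism `a ↦ ∑_{v ∈ F} π_v(a_v)`. -/
def partialπ (F : Finset Λ) : X.algA →⋆ₙₐ[ℂ] B where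
  toFun a := ∑ v ∈ F, R.π v (C0Sum.eval v a)
  map_smul' c a := by simp [Finset.smul_sum]
  map_zero' := by simp
  map_add' a b := by simp [Finset.sum_add_distrib]
  map_mul' a b := by
    rw [Finset.sum_mul_sum]
    refine Finset.sum_congr rfl fun v hv => ?_
    rw [Finset.sum_eq_single v (fun w _ hw => R.π_mul_π_of_ne hw.symm _ _) (fun h => absurd hv h),
      map_mul, map_mul]
  map_star' a := by simp [map_star]

/-- The sum over a finite set `t` is the image under the `*`-homomorphism `partialπ t` of the
corresponding partial sum of `a`. It is therefore no larger in norm, and the Cauchy criterion passes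
from the `c₀`-sum to `B`. -/
lemma summable_π (a : X.algA) : Summable fun v => R.π v (C0Sum.eval v a) := by
  rw [summable_iff_vanishing_norm]
  intro ε hε
  obtain ⟨F, hF⟩ := summable_iff_vanishing_norm.mp (hasSum_C0Sum a).summable ε hε
  refine ⟨F, fun t ht => lt_of_le_of_lt ?_ (hF t ht)⟩
  refine le_trans (le_of_eq ?_) (NonUnitalStarAlgHom.norm_apply_le (R.partialπ t) _)
  congr 1
  change _ = ∑ v ∈ t, R.π v (C0Sum.eval v _)
  refine Finset.sum_congr rfl fun v hv => ?_
  rw [map_sum, Finset.sum_eq_single v (fun w _ hw => C0Sum.eval_single_ne hw.symm _)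
    (fun h => absurd hv h), C0Sum.eval_single_same]

lemma tsum_π_mul (a : X.algA) {v : Λ} (b : X.A v) :
    (∑' u, R.π u (C0Sum.eval u a)) * R.π v b = R.π v (C0Sum.eval v a * b) := by
  rw [← (R.summable_π a).tsum_mul_right, tsum_eq_single v fun u hu => R.π_mul_π_of_ne hu _ _,
    map_mul]

/-- The homomorphism `⨁ᵥ Aᵥ → B` with components `π_v`. -/
def sumπ : X.algA →⋆ₙₐ[ℂ] B where
  toFun a := ∑' v, R.π v (C0Sum.eval v a)
  map_smul' c a := by
    simp only [map_smul]
    exact (R.summable_π a).tsum_const_smul c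
  map_zero' := by simp
  map_add' a b := by
    simp only [map_add]
    exact (R.summable_π a).tsum_add (R.summable_π b)
  map_mul' a b := by
    rw [← (R.summable_π b).tsum_mul_left]
    exact tsum_congr fun v => by rw [R.tsum_π_mul, map_mul (C0Sum.eval v)]
  map_star' a := by
    simp only [map_star]
    exact tsum_star.symm

lemma hasSum_sumπ (a : X.algA) : HasSum (fun v => R.π v (C0Sum.eval v a)) (R.sumπ a) :=
  (R.summable_π a).hasSum

lemma sumπ_single (v : Λ) (a : X.A v) : R.sumπ (C0Sum.single v a) = R.π v a := by
  refine (tsum_eq_single v fun w hw => ?_).trans ?_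
  · rw [C0Sum.eval_single_ne hw, map_zero]
  · rw [C0Sum.eval_single_same]

/-- Only the term at the range of `f` survives; in `ρ_mul_sumπ` it is the term at the source. -/
lemma sumπ_mul_ρ {v w : Λ} (f : v ⟶ w) (a : X.algA) (x : X.X f) :
    R.sumπ a * R.ρ f x = R.ρ f ((X.X f).φ (C0Sum.eval w a) x) := by
  refine ((R.hasSum_sumπ a).mul_right _).unique ?_
  rw [R.ρ_φ]
  exact hasSum_single w fun u hu => R.π_mul_ρ_of_ne f hu _ _

lemma ρ_mul_sumπ {v w : Λ} (f : v ⟶ w) (x : X.X f) (a : X.algA) :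
    R.ρ f x * R.sumπ a = R.ρ f ((X.X f).rsmul x (C0Sum.eval v a)) := by
  refine ((R.hasSum_sumπ a).mul_left _).unique ?_
  rw [R.ρ_rsmul]
  exact hasSum_single v fun u hu => R.ρ_mul_π_of_ne f hu.symm _ _

lemma star_ρ_mul_ρ_of_ne {n : Fin k → ℕ} {l l' : G.PathOf n} (h : l ≠ l') (x : X.X l.1.hom)
    (y : X.X l'.1.hom) : star (R.ρ l.1.hom x) * R.ρ l'.1.hom y = 0 :=
  R.ρ_star_mul_eq_zero _ _ _ _ (l.2.trans l'.2.symm) fun e => h (Subtype.ext e)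

/-- Relation (3) kills the cross terms of `(∑ ρ_λ(x_λ))* (∑ ρ_λ(x_λ))`. What remains is the image of
`∑ ⟨x_λ, x_λ⟩` under the contraction `sumπ`. This is the estimate that makes `ρ` extend to the
`ℓ²`-sum. -/
lemma sq_norm_sum_ρ {n : Fin k → ℕ} (F : Finset (G.PathOf n)) (x : ∀ l : G.PathOf n, X.X l.1.hom) :
    ‖∑ l ∈ F, R.ρ l.1.hom (x l)‖ ^ 2 ≤ ‖∑ l ∈ F, (X.summand n l).inner (x l) (x l)‖ := by
  rw [pow_two, ← CStarRing.norm_star_mul_self]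
  refine le_trans (le_of_eq ?_) (NonUnitalStarAlgHom.norm_apply_le R.sumπ _)
  congr 1
  rw [map_sum, star_sum, Finset.sum_mul_sum]
  refine Finset.sum_congr rfl fun l hl => ?_
  rw [Finset.sum_eq_single l (fun l' _ h => R.star_ρ_mul_ρ_of_ne h.symm _ _)
    (fun h => absurd hl h), R.ρ_star_mul]
  exact (R.sumπ_single _ _).symm

lemma summable_ρ {n : Fin k → ℕ} (x : X.fibre n) :
    Summable fun l : G.PathOf n => R.ρ l.1.hom (X.coord l.1.hom l.2 x) := by
  rw [summable_iff_vanishing_norm]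
  intro ε hε
  -- The tolerance is `ε ^ 2` because `sq_norm_sum_ρ` bounds the square of the norm.
  obtain ⟨F, hF⟩ := summable_iff_vanishing_norm.mp
    (Corr.L2Sum.summable_inner (E := X.summand n) x x) (ε ^ 2) (by positivity)
  refine ⟨F, fun t ht => lt_of_pow_lt_pow_left₀ 2 hε.le ?_⟩
  exact (R.sq_norm_sum_ρ t _).trans_lt (hF t ht)

/-- The map `Yₙ → B` with components `ρ_λ`. -/
def sumρ (n : Fin k → ℕ) : X.fibre n →ₗ[ℂ] B where
  toFun x := ∑' l : G.PathOf n, R.ρ l.1.hom (X.coord l.1.hom l.2 x)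
  map_add' x y := by
    simp only [map_add]
    exact (R.summable_ρ x).tsum_add (R.summable_ρ y)
  map_smul' c x := by
    simp only [map_smul]
    exact (R.summable_ρ x).tsum_const_smul c

lemma hasSum_sumρ {n : Fin k → ℕ} (x : X.fibre n) :
    HasSum (fun l : G.PathOf n => R.ρ l.1.hom (X.coord l.1.hom l.2 x)) (R.sumρ n x) :=
  (R.summable_ρ x).hasSum

lemma sumρ_incl {n : Fin k → ℕ} {v w : Λ} (f : v ⟶ w) (h : G.d f = n) (x : X.X f) :
    R.sumρ n (X.incl f h x) = R.ρ f x := by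
  refine (tsum_eq_single (.mk f h : G.PathOf n) fun l hl => ?_).trans ?_
  · rw [X.coord_incl_ne f h l.1.hom l.2 hl, map_zero]
  · rw [X.coord_incl_same]

lemma star_ρ_mul_sumρ {n : Fin k → ℕ} (l : G.PathOf n) (x : X.X l.1.hom) (y : X.fibre n) :
    star (R.ρ l.1.hom x) * R.sumρ n y =
      R.π _ ((X.X l.1.hom).inner x (X.coord l.1.hom l.2 y)) := by
  refine ((R.hasSum_sumρ y).mul_left _).unique ?_
  rw [← R.ρ_star_mul]
  exact hasSum_single l fun l' h => R.star_ρ_mul_ρ_of_ne h.symm _ _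

/-- In each identity both sides are sums of convergent series over `Λⁿ`, and the series agree term
by term. -/
lemma isRep_sumρ (n : Fin k → ℕ) : (X.fibre n).IsRep (R.sumρ n) R.sumπ where
  map_φ a x := by
    refine (R.hasSum_sumρ _).unique (((R.hasSum_sumρ x).mul_left _).congr_fun fun l => ?_)
    exact (R.sumπ_mul_ρ _ _ _).symm
  map_rsmul x a := by
    refine (R.hasSum_sumρ _).unique (((R.hasSum_sumρ x).mul_right _).congr_fun fun l => ?_)
    exact (R.ρ_mul_sumπ _ _ _).symm
  map_inner x y := by
    have h := (Corr.L2Sum.hasSum_inner (E := X.summand n) x y).map R.sumπ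
      (continuous_starHom R.sumπ)
    -- Only the factor of `x` is expanded. Orthogonality collapses the sum for `y` to the summand
    -- `l`, so no double series arises.
    refine h.unique (((R.hasSum_sumρ x).star.mul_right _).congr_fun fun l => ?_)
    rw [R.star_ρ_mul_sumρ]
    exact R.sumπ_single _ _

/-- Both sides are bilinear and separately continuous in `x` and `y`, so both may be taken in single
summands. There the claim is relation (2), in the composable and the non-composable case. -/
lemma sumρ_mul {m n : Fin k → ℕ} (x : X.fibre m) (y : X.fibre n) :
    R.sumρ (m + n) (X.mul m n x y) = R.sumρ m x * R.sumρ n y := by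
  have hc : ∀ p, Continuous (R.sumρ p) := fun p => (R.isRep_sumρ p).continuous
  refine fibre_linearMap_ext (S := R.sumρ (m + n) ∘ₗ (X.mul m n).flip y)
    (T := (LinearMap.mul ℂ B).flip (R.sumρ n y) ∘ₗ R.sumρ m)
    ((hc _).comp (continuous_mul_left y)) ((hc m).mul continuous_const) (fun α hα x => ?_) x
  refine fibre_linearMap_ext (S := R.sumρ (m + n) ∘ₗ X.mul m n (X.incl α hα x))
    (T := LinearMap.mul ℂ B (R.sumρ m (X.incl α hα x)) ∘ₗ R.sumρ n)
    ((hc _).comp (continuous_mul_right _)) (continuous_const.mul (hc n)) (fun β hβ y => ?_) y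
  rename_i v w u v'
  change R.sumρ (m + n) (X.mul m n (X.incl α hα x) (X.incl β hβ y)) =
    R.sumρ m (X.incl α hα x) * R.sumρ n (X.incl β hβ y)
  rw [R.sumρ_incl, R.sumρ_incl]
  by_cases h : v = v'
  · subst h
    rw [X.incl_mul_incl α β hα hβ (by rw [G.d_comp, hα, hβ]), R.sumρ_incl, R.ρ_mul]
  · rw [X.incl_mul_incl_eq_zero α β hα hβ h, map_zero, R.ρ_mul_eq_zero _ _ _ _ h]

/-- Paths of degree `0` are exactly the vertices. After reindexing, the two series agree by
`ρ_vertex`. -/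
lemma sumρ_unitMap (a : X.algA) : R.sumρ 0 (X.unitMap a) = R.sumπ a := by
  refine (R.hasSum_sumρ _).unique ?_
  rw [← (vertexEquiv G).hasSum_iff]
  refine (R.hasSum_sumπ a).congr_fun fun v => ?_
  exact R.ρ_vertex v _

/-- The representation `ψ^{(ρ, π)}` of `Y_X` determined by a representation `(ρ, π)` of `X`. -/
def toProductSystem : X.productSystem.Rep B where
  ψ := R.sumρ
  ψe := R.sumπ
  ψ_unit := R.sumρ_unitMap
  isRep := R.isRep_sumρ
  map_mul _ _ := R.sumρ_mul

end Rep

/-- Representations of `Y_X` correspond to representations of `X`. -/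
def repEquiv (X : LambdaSystem G) (B : Type u) [NonUnitalCStarAlgebra B] :
    X.productSystem.Rep B ≃ X.Rep B where
  toFun := inducedRep
  invFun R := R.toProductSystem
  left_inv ψ := ψ_ext fun f x => (inducedRep ψ).sumρ_incl f rfl x
  right_inv R := Rep.ext_of_ρ fun f x => R.sumρ_incl f rfl x

lemma repEquiv_symm_ι (R : X.Rep B) {v w : Λ} (f : v ⟶ w) (x : X.X f) :
    ((repEquiv X B).symm R).ψ (G.d f) (X.ι f x) = R.ρ f x :=
  R.sumρ_incl f rfl x

end LambdaSystem

/-! ### Construction of the Toeplitz algebra -/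

/-- A contractive `*`-homomorphism defined on a dense subset extends. -/
lemma exists_starHom_extension {F T C : Type u} [NonUnitalNonAssocRing F] [Module ℂ F]
    [NonUnitalCStarAlgebra T] [NonUnitalCStarAlgebra C] (f : F →ₙₐ[ℂ] T) (g : F →ₙₐ[ℂ] C)
    (hf : DenseRange f) (hle : ∀ x, ‖g x‖ ≤ ‖f x‖) {s : Set T}
    (hs : Dense (NonUnitalStarAlgebra.adjoin ℂ s : Set T))
    (hstar : ∀ t ∈ s, ∃ x y, f x = t ∧ f y = star t ∧ g y = star (g x)) :
    ∃ Φ : T →⋆ₙₐ[ℂ] C, ∀ x, Φ (f x) = g x := by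
  let f' : F →ₗ[ℂ] T := f
  let g' : F →ₗ[ℂ] C := g
  let Φ : T →L[ℂ] C := g'.extendOfNorm f'
  -- The domination `hle`, a bound with constant `1`, makes `f x ↦ g x` well defined and continuous
  -- on the dense range of `f`.
  have hΦ : ∀ x, Φ (f x) = g x :=
    LinearMap.extendOfNorm_eq (f := g') (e := f') hf ⟨1, fun x => (hle x).trans_eq (one_mul _).symm⟩
  have hmul : ∀ a b, Φ (a * b) = Φ a * Φ b := by
    refine hf.induction_on₂ ?_ fun x y => ?_
    · exact isClosed_eq (by fun_prop) (by fun_prop)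
    · rw [← map_mul f, hΦ, hΦ, hΦ, map_mul]
  -- The algebra `F` carries no involution, so this cannot be pulled back along `f`. It is checked
  -- on `s`, propagated through the `*`-algebra generated by `s`, and extended by density.
  have hst : ∀ a, Φ (star a) = star (Φ a) := by
    refine fun a => congrFun (Continuous.ext_on hs (f := fun a => Φ (star a))
      (g := fun a => star (Φ a)) (by fun_prop) (by fun_prop) fun t ht => ?_) a
    dsimp only
    induction ht using NonUnitalStarAlgebra.adjoin_induction with
    | mem t ht =>
      obtain ⟨x, y, rfl, hy, hxy⟩ := hstar t ht
      rw [← hy, hΦ, hΦ, hxy]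
    | add s t hs ht hs' ht' => rw [star_add, map_add, map_add, star_add, hs', ht']
    | zero => simp
    | mul s t hs ht hs' ht' => rw [star_mul, hmul, hmul, star_mul, hs', ht']
    | smul c t ht ht' => rw [star_smul, map_smul, map_smul, star_smul, ht']
    | star t ht ht' => rw [ht', star_star, star_star]
  exact ⟨{ toFun := Φ, map_smul' := map_smul Φ, map_zero' := map_zero Φ, map_add' := map_add Φ,
           map_mul' := hmul, map_star' := hst }, hΦ⟩

namespace ProductSystem.Rep

variable {P : Type} [AddMonoid P] {A : Type u} [NonUnitalCStarAlgebra A] {Y : ProductSystem P A}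
  {B C : Type u} [NonUnitalCStarAlgebra B] [NonUnitalCStarAlgebra C]

/-- The image of a representation. -/
def image (ψ : Y.Rep B) : Set B := {t | ∃ p y, t = ψ.ψ p y}

/-- A representation in `B` with values in a closed `*`-subalgebra. -/
def codRestrict (ψ : Y.Rep B) (S : NonUnitalStarSubalgebra ℂ B) [IsClosed (S : Set B)]
    (h : ψ.image ⊆ S) : Y.Rep S where
  ψ p :=
    { toFun := fun y => ⟨ψ.ψ p y, h ⟨p, y, rfl⟩⟩
      map_add' := fun x y => Subtype.ext (map_add (ψ.ψ p) x y)
      map_smul' := fun c x => Subtype.ext (map_smul (ψ.ψ p) c x) }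
  ψe := NonUnitalStarAlgHom.codRestrict ψ.ψe S fun a => h ⟨0, Y.unit a, (ψ.ψ_unit a).symm⟩
  ψ_unit a := Subtype.ext (ψ.ψ_unit a)
  isRep p :=
    { map_φ := fun a x => Subtype.ext ((ψ.isRep p).map_φ a x)
      map_rsmul := fun x a => Subtype.ext ((ψ.isRep p).map_rsmul x a)
      map_inner := fun x y => Subtype.ext ((ψ.isRep p).map_inner x y) }
  map_mul p q x y := Subtype.ext (ψ.map_mul p q x y)

/-- The product of a family of representations. -/
def pi {I : Type u} {D : I → Type u} [∀ i, NonUnitalCStarAlgebra (D i)] (ψ : ∀ i, Y.Rep (D i)) :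
    Y.Rep (lp D ∞) where
  ψ p :=
    -- Contractivity gives the bound `‖y‖` uniformly in `i`, so the family lies in the
    -- `ℓ^∞`-product.
    { toFun := fun y => ⟨fun i => (ψ i).ψ p y, memℓp_infty ⟨‖y‖, by
        rintro _ ⟨i, rfl⟩
        exact ((ψ i).isRep p).norm_le y⟩⟩
      map_add' := fun x y => lp.ext (funext fun i => map_add ((ψ i).ψ p) x y)
      map_smul' := fun c x => lp.ext (funext fun i => map_smul ((ψ i).ψ p) c x) }
  ψe :=
    { toFun := fun a => ⟨fun i => (ψ i).ψe a, memℓp_infty ⟨‖a‖, by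
        rintro _ ⟨i, rfl⟩
        exact NonUnitalStarAlgHom.norm_apply_le (ψ i).ψe a⟩⟩
      map_smul' := fun c a => lp.ext (funext fun i => map_smul (ψ i).ψe c a)
      map_zero' := lp.ext (funext fun i => map_zero (ψ i).ψe)
      map_add' := fun a b => lp.ext (funext fun i => map_add (ψ i).ψe a b)
      map_mul' := fun a b => lp.ext (funext fun i => _root_.map_mul (ψ i).ψe a b)
      map_star' := fun a => lp.ext (funext fun i => map_star (ψ i).ψe a) }
  ψ_unit a := lp.ext (funext fun i => (ψ i).ψ_unit a)
  isRep p :=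
    { map_φ := fun a x => lp.ext (funext fun i => ((ψ i).isRep p).map_φ a x)
      map_rsmul := fun x a => lp.ext (funext fun i => ((ψ i).isRep p).map_rsmul x a)
      map_inner := fun x y => lp.ext (funext fun i => ((ψ i).isRep p).map_inner x y) }
  map_mul p q x y := lp.ext (funext fun i => (ψ i).map_mul p q x y)

/-- The free algebra on formal symbols for the elements of `Y` and their adjoints. -/
abbrev Word (Y : ProductSystem P A) : Type u :=
  FreeNonUnitalNonAssocAlgebra ℂ ((Σ p, Y.Y p) ⊕ (Σ p, Y.Y p))

/-- The homomorphism from the free algebra determined by a representation. -/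
def wordEval (ψ : Y.Rep B) : Word Y →ₙₐ[ℂ] B :=
  FreeNonUnitalNonAssocAlgebra.lift ℂ
    (Sum.elim (fun y => ψ.ψ y.1 y.2) fun y => star (ψ.ψ y.1 y.2))

lemma wordEval_inl (ψ : Y.Rep B) (y : Σ p, Y.Y p) :
    ψ.wordEval (.of ℂ (.inl y)) = ψ.ψ y.1 y.2 :=
  FreeNonUnitalNonAssocAlgebra.lift_of_apply _ _ _

lemma wordEval_inr (ψ : Y.Rep B) (y : Σ p, Y.Y p) :
    ψ.wordEval (.of ℂ (.inr y)) = star (ψ.ψ y.1 y.2) :=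
  FreeNonUnitalNonAssocAlgebra.lift_of_apply _ _ _

/-- Two homomorphisms on the free algebra that agree on the symbols are equal. As `Φ` is
contractive, the word seminorm of `ψ` is then dominated by that of `φ`. -/
lemma map_wordEval {φ : Y.Rep B} {ψ : Y.Rep C} (Φ : B →⋆ₙₐ[ℂ] C)
    (h : ∀ p y, Φ (φ.ψ p y) = ψ.ψ p y) (x : Word Y) : Φ (φ.wordEval x) = ψ.wordEval x := by
  have : (Φ : B →ₙₐ[ℂ] C).comp φ.wordEval = ψ.wordEval := by
    refine FreeNonUnitalNonAssocAlgebra.hom_ext ℂ fun y => ?_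
    change Φ (φ.wordEval (.of ℂ y)) = ψ.wordEval (.of ℂ y)
    obtain y | y := y
    · rw [wordEval_inl, wordEval_inl, h]
    · rw [wordEval_inr, wordEval_inr, map_star, h]
  exact DFunLike.congr_fun this x

lemma adjoin_image_subset_range (ψ : Y.Rep B) :
    (NonUnitalStarAlgebra.adjoin ℂ ψ.image : Set B) ⊆ Set.range ψ.wordEval := by
  -- The generated `*`-algebra is the algebra generated by the image and its adjoints; the second
  -- kind of symbol in `Word` accounts for the adjoints.
  change NonUnitalAlgebra.adjoin ℂ (ψ.image ∪ star ψ.image) ≤ NonUnitalAlgHom.range ψ.wordEval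
  rw [NonUnitalAlgebra.adjoin_le_iff]
  rintro t (⟨p, y, rfl⟩ | ⟨p, y, h⟩)
  · exact ⟨_, ψ.wordEval_inl ⟨p, y⟩⟩
  · exact ⟨_, (ψ.wordEval_inr ⟨p, y⟩).trans (by rw [← h, star_star])⟩

/-- The seminorms on the free algebra that come from representations. -/
def repNorms (Y : ProductSystem P A) : Set (Word Y → ℝ) :=
  {N | ∃ (B : Type u) (_ : NonUnitalCStarAlgebra B) (ψ : Y.Rep B), ∀ x, N x = ‖ψ.wordEval x‖}

/-- Domination of word seminorms is all that is needed to factor `ψ` through `i`: the assignment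
from `i.wordEval x` to `ψ.wordEval x` is well defined and contractive on a dense subset. -/
lemma exists_starHom_of_norm_le (i : Y.Rep B)
    (hi : Dense (NonUnitalStarAlgebra.adjoin ℂ i.image : Set B))
    (ψ : Y.Rep C) (h : ∀ x, ‖ψ.wordEval x‖ ≤ ‖i.wordEval x‖) :
    ∃ Φ : B →⋆ₙₐ[ℂ] C, ∀ p y, Φ (i.ψ p y) = ψ.ψ p y := by
  obtain ⟨Φ, hΦ⟩ := exists_starHom_extension i.wordEval ψ.wordEval
    (hi.mono i.adjoin_image_subset_range) h hi (by
      rintro t ⟨p, y, rfl⟩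
      refine ⟨_, _, i.wordEval_inl ⟨p, y⟩, i.wordEval_inr ⟨p, y⟩, ?_⟩
      rw [wordEval_inl, wordEval_inr])
  refine ⟨Φ, fun p y => ?_⟩
  rw [← i.wordEval_inl ⟨p, y⟩, hΦ, wordEval_inl]

/-- Each element of the `*`-algebra generated by the image in `B` already belongs to the `*`-algebra
generated inside the closure, by induction on its construction. Density then holds by the definition
of the closure. -/
lemma dense_adjoin_codRestrict (ψ : Y.Rep B)
    [IsClosed ((NonUnitalStarAlgebra.adjoin ℂ ψ.image).topologicalClosure : Set B)]
    (h : ψ.image ⊆ (NonUnitalStarAlgebra.adjoin ℂ ψ.image).topologicalClosure) :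
    Dense (NonUnitalStarAlgebra.adjoin ℂ (ψ.codRestrict _ h).image :
      Set (NonUnitalStarAlgebra.adjoin ℂ ψ.image).topologicalClosure) := by
  have key : ∀ t (ht : t ∈ NonUnitalStarAlgebra.adjoin ℂ ψ.image),
      (⟨t, subset_closure ht⟩ : (NonUnitalStarAlgebra.adjoin ℂ ψ.image).topologicalClosure) ∈
        NonUnitalStarAlgebra.adjoin ℂ (ψ.codRestrict _ h).image := by
    intro t ht
    induction ht using NonUnitalStarAlgebra.adjoin_induction with
    | mem t ht =>
      obtain ⟨p, y, rfl⟩ := ht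
      exact NonUnitalStarAlgebra.subset_adjoin _ _ ⟨p, y, rfl⟩
    | add s t hs ht hs' ht' => exact add_mem hs' ht'
    | zero => exact zero_mem _
    | mul s t hs ht hs' ht' => exact mul_mem hs' ht'
    | smul c t ht ht' => exact SMulMemClass.smul_mem c ht'
    | star t ht ht' => exact star_mem ht'
  intro t
  rw [closure_subtype]
  refine closure_mono ?_ t.2
  exact fun b hb => ⟨⟨b, subset_closure hb⟩, key b hb, rfl⟩

/-- The Toeplitz algebra of a product system exists. -/
theorem exists_isToeplitz (Y : ProductSystem P A) :
    ∃ (T : Type u) (_ : NonUnitalCStarAlgebra T) (i : Y.Rep T), i.IsToeplitz := by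
  -- The product is indexed by seminorms and not by representations: the seminorms are real
  -- functions on `Word Y` and form a type in universe `u`, whereas all representations together
  -- need not.
  choose D instD ψD hD using fun N : repNorms Y => N.2
  let j : Y.Rep (lp D ∞) := pi ψD
  let S := (NonUnitalStarAlgebra.adjoin ℂ j.image).topologicalClosure
  have : IsClosed (S : Set (lp D ∞)) := NonUnitalStarSubalgebra.isClosed_topologicalClosure _
  have hj : j.image ⊆ S := (NonUnitalStarAlgebra.subset_adjoin ℂ _).trans subset_closure
  have hd := j.dense_adjoin_codRestrict hj
  refine ⟨S, inferInstance, j.codRestrict S hj, hd, fun C _ ψ => ?_⟩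
  refine exists_starHom_of_norm_le _ hd ψ fun x => ?_
  -- The representation chosen for this index may differ from `ψ`, but it has the same word norms,
  -- and only those enter the comparison.
  let N : repNorms Y := ⟨fun x => ‖ψ.wordEval x‖, C, inferInstance, ψ, fun _ => rfl⟩
  let ev : S →⋆ₙₐ[ℂ] D N :=
    { toFun := fun t => t.1 N
      map_smul' := fun _ _ => rfl
      map_zero' := rfl
      map_add' := fun _ _ => rfl
      map_mul' := fun _ _ => rfl
      map_star' := fun _ => rfl }
  have h1 : ev ((j.codRestrict S hj).wordEval x) = (ψD N).wordEval x :=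
    map_wordEval ev (fun _ _ => rfl) x
  calc ‖ψ.wordEval x‖ = ‖(ψD N).wordEval x‖ := hD N x
    _ ≤ _ := by
      rw [← h1]
      exact NonUnitalStarAlgHom.norm_apply_le ev _

/-- `*`-homomorphisms on the Toeplitz algebra are determined on the image of `Y`. -/
lemma IsToeplitz.hom_ext {i : Y.Rep B} (hi : i.IsToeplitz) {Φ Ψ : B →⋆ₙₐ[ℂ] C}
    (h : ∀ p y, Φ (i.ψ p y) = Ψ (i.ψ p y)) : Φ = Ψ := by
  have := Continuous.ext_on hi.generates (continuous_starHom Φ) (continuous_starHom Ψ)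
    (g := Ψ) (f := Φ) fun t ht => ?_
  · exact DFunLike.coe_injective this
  induction ht using NonUnitalStarAlgebra.adjoin_induction with
  | mem t ht => obtain ⟨p, y, rfl⟩ := ht; exact h p y
  | add s t hs ht hs' ht' => rw [map_add, map_add, hs', ht']
  | zero => rw [map_zero, map_zero]
  | mul s t hs ht hs' ht' => rw [_root_.map_mul, _root_.map_mul, hs', ht']
  | smul c t ht ht' => rw [map_smul, map_smul, ht']
  | star t ht ht' => rw [map_star, map_star, ht']

end ProductSystem.Rep

/-! ### Universality for `X` and the proposition -/

/-- Existence is the factorisation of `ψ^{(ρ', π')}` through `i`. For uniqueness, two homomorphisms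
that agree on every `ρ_λ` agree on the summands of each fibre, by continuity on the whole of `Y`,
and hence on the algebra that its image generates. -/
lemma LambdaSystem.Rep.isUniversal_of_isToeplitz {k : ℕ} {Λ : Type u} [SmallCategory Λ]
    {G : KGraph k Λ} {X : LambdaSystem G} {T : Type u} [NonUnitalCStarAlgebra T]
    {i : X.productSystem.Rep T} (hi : i.IsToeplitz) {R : X.Rep T} (hR : R.IsInducedBy i) :
    R.IsUniversal := by
  intro C _ R'
  obtain ⟨Φ, hΦ⟩ := hi.lift C R'.toProductSystem
  have hρ : ∀ {v w : Λ} (f : v ⟶ w) (x : X.X f), Φ (R.ρ f x) = R'.ρ f x := fun f x =>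
    (congrArg Φ (hR.1 f x)).trans ((hΦ _ _).trans (R'.sumρ_incl f rfl x))
  refine ⟨Φ, ⟨hρ, fun v a => ?_⟩, fun Ψ hΨ => ?_⟩
  -- Agreement on `π_v` is the case of an identity path.
  · rw [← R.ρ_vertex, hρ, R'.ρ_vertex]
  · refine hi.hom_ext fun n y => ?_
    refine fibre_linearMap_ext (X := X) (S := (Ψ : T →ₗ[ℂ] C) ∘ₗ i.ψ n)
      (T := (Φ : T →ₗ[ℂ] C) ∘ₗ i.ψ n)
      ((continuous_starHom Ψ).comp (i.isRep n).continuous)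
      ((continuous_starHom Φ).comp (i.isRep n).continuous) (fun f hf x => ?_) y
    have e : R.ρ f x = i.ψ n (X.incl f hf x) := (hR.1 f x).trans (ψ_incl i f hf x)
    exact (congrArg Ψ e.symm).trans ((hΨ.1 f x).trans ((hρ f x).symm.trans (congrArg Φ e)))

end

theorem proposition3p2p3 {k : ℕ} {Λ : Type u} [SmallCategory Λ] (G : KGraph k Λ)
    (X : LambdaSystem G) (hX : X.IsRegular) :
    (∀ (B : Type u) [NonUnitalCStarAlgebra B],
      ∃ e : X.productSystem.Rep B ≃ X.Rep B,
        (∀ ψ : X.productSystem.Rep B, (e ψ).IsInducedBy ψ) ∧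
        (∀ R : X.Rep B,
          (∀ {v w : Λ} (f : v ⟶ w) (x : X.X f), (e.symm R).ψ (G.d f) (X.ι f x) = R.ρ f x) ∧
          ∀ ψ : X.productSystem.Rep B,
            (∀ {v w : Λ} (f : v ⟶ w) (x : X.X f), ψ.ψ (G.d f) (X.ι f x) = R.ρ f x) →
              ψ = e.symm R)) ∧
    (∃ (T : Type u) (_ : NonUnitalCStarAlgebra T) (i : X.productSystem.Rep T), i.IsToeplitz) ∧
    (∀ (T : Type u) [NonUnitalCStarAlgebra T] (i : X.productSystem.Rep T), i.IsToeplitz →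
      ∀ R : X.Rep T, R.IsInducedBy i → R.IsUniversal) := by
  refine ⟨fun B _ => ⟨X.repEquiv B, LambdaSystem.inducedRep_isInducedBy, fun R =>
    ⟨fun f x => LambdaSystem.repEquiv_symm_ι R f x, fun ψ h => ?_⟩⟩,
    ProductSystem.Rep.exists_isToeplitz _, fun T _ i hi R hR =>
      LambdaSystem.Rep.isUniversal_of_isToeplitz hi hR⟩
  exact LambdaSystem.ψ_ext fun f x => (h f x).trans (LambdaSystem.repEquiv_symm_ι R f x).symm
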